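/- Let $V=\{v_1,\dots,v_n\}$ be a finite set of Boolean variables. An *mvd clause* over $V$ is an implication $X\rightarrow Y\vee Z$, where $X,Y,Z$ are pairwise disjoint, possibly empty, conjunctions (sets) of variables with $X\cup Y\cup Z=V$. An interpretation $I$ of $V$ *violates* it if every variable of $X$ is true in $I$ and one of the following holds: (a) $Y$ and $Z$ are non-empty, and some $v\in Y$ and some $w\in Z$ are both false in $I$; (b) one of $Y,Z$ is empty, and exactly one variable of $V$ is false in $I$, and this variable lies in $Y\cup Z$; (c) no variable is false in $I$ and the clause is $V\rightarrow\mathbf F$ (that is, $X=V$, $Y=Z=\emptyset$). A *multivalued dependency formula* (MVDF) over $V$ is a finite conjunction $T$ of mvd clauses; $I\models T$ if $I$ violates none of them. A *2-quasi-Horn clause* over $V$ is a propositional clause with at most two unnegated literals, and $T\models e$ means that every interpretation $I\models T$ satisfies the clause $e$. The learning framework $\mathfrak F(\mathrm{MVDF}_{\mathcal Q})=(E_{\mathcal Q},\mathcal L_M,\mu_{\mathcal Q})$ has as examples $E_{\mathcal Q}$ the 2-quasi-Horn clauses over $V$, as concept representations $\mathcal L_M$ the MVDFs over $V$, and $\mu_{\mathcal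 Q}(T)=\{e\in E_{\mathcal Q}\mid T\models e\}$. For an unknown target $T\in\mathcal L_M$, a membership query asks for some $e\in E_{\mathcal Q}$ whether $e\in\mu_{\mathcal Q}(T)$; an equivalence query asks for some $H\in\mathcal L_M$ whether $\mu_{\mathcal Q}(H)=\mu_{\mathcal Q}(T)$, and if not, the oracle returns an arbitrary counterexample $e\in\mu_{\mathcal Q}(H)\oplus\mu_{\mathcal Q}(T)$. **Theorem.** $\mathfrak F(\mathrm{MVDF}_{\mathcal Q})$ is polynomial time exactly learnable: there are a deterministic algorithm $A$ and a polynomial $p(\cdot,\cdot)$ such that for every $n$, $V=\{v_1,\dots,v_n\}$ (with $n$ given to $A$) and every target $T\in\mathcal L_M$, whatever counterexamples are returned, $A$ halts, outputs some $T'\in\mathcal L_M$ with $\mu_{\mathcal Q}(T')=\mu_{\mathcal Q}(T)$, and at every step of its computation the time used up to that step is at most $p(|T|,|e|)$, where $|e|$ is the length of the largest counterexample seen so far ($0$ if there was none) and each call to an oracle counts as one step. -/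

import Mathlib

namespace ExactLearning

/-! ## Learning frameworks -/

/-- A learning framework `(E, L, μ)`: examples, concept representations, and the map sending a
representation to the concept it denotes. The concept class is the range of `μ`. -/
structure LearningFramework where
  Example : Type
  Rep : Type
  μ : Rep → Set Example

/-- Finite binary trees, the data on which learning algorithms operate. -/
inductive Data where
  | nil : Data
  | cons : Data → Data → Data
  deriving DecidableEq

namespace Data

/-- Number of nodes of a tree. -/
def size : Data → ℕ
  | nil => 1
  | cons a b => a.size + b.size + 1

def head : Data → Data
  | nil => nil
  | cons a _ => a

def tail : Data → Data
  | nil => nil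
  | cons _ b => b

/-- Booleans as trees: `false` is `nil`, and `true` is `cons nil nil`. -/
def ofBool : Bool → Data
  | false => nil
  | true => cons nil nil

/-- Lists as trees: the empty list is `nil`, and `cons` prepends an element. -/
def ofList : List Data → Data
  | [] => nil
  | a :: l => cons a (ofList l)

theorem ofBool_injective : Function.Injective ofBool := by
  intro a b h
  cases a <;> cases b <;> simp_all [ofBool]

theorem ofList_injective : Function.Injective ofList := by
  intro l
  induction l with
  | nil => intro m h; cases m <;> simp_all [ofList]
  | cons a l ih =>
    intro m h
    cases m with
    | nil => simp [ofList] at h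
    | cons b m =>
      simp only [ofList, Data.cons.injEq] at h
      rw [h.1, ih h.2]

end Data

/-- A learning framework whose examples and representations are written as trees,
injectively. -/
structure EncodedFramework extends LearningFramework where
  codeExample : Example → Data
  codeExample_injective : Function.Injective codeExample
  codeRep : Rep → Data
  codeRep_injective : Function.Injective codeRep

namespace EncodedFramework

/-- The length `|e|` of an example. -/
def sizeExample (F : EncodedFramework) (e : F.Example) : ℕ := (F.codeExample e).size

/-- The length `|l|` of a concept representation. -/
def sizeRep (F : EncodedFramework) (l : F.Rep) : ℕ := (F.codeRep l).size

end EncodedFramework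

/-! ## Learning algorithms

Algorithms are programs of a deterministic `while` language over tree-valued registers, extended
by calls to the membership and the equivalence oracle. -/

/-- Contents of the registers. -/
abbrev Store := ℕ → Data

inductive Expr where
  | reg : ℕ → Expr
  | nil : Expr
  | cons : Expr → Expr → Expr
  | head : Expr → Expr
  | tail : Expr → Expr
  | eq : Expr → Expr → Expr

namespace Expr

def eval (s : Store) : Expr → Data
  | reg x => s x
  | nil => Data.nil
  | cons a b => Data.cons (a.eval s) (b.eval s)
  | head a => (a.eval s).head
  | tail a => (a.eval s).tail
  | eq a b => Data.ofBool (decide (a.eval s = b.eval s))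

/-- Time for evaluating an expression: the value of every subexpression (including the expression
itself) is charged with its full size, so that copying a value takes time linear in its size. -/
def cost (s : Store) : Expr → ℕ
  | reg x => (s x).size
  | nil => 1
  | cons a b => a.cost s + b.cost s + (eval s (cons a b)).size
  | head a => a.cost s + (eval s (head a)).size
  | tail a => a.cost s + (eval s (tail a)).size
  | eq a b => a.cost s + b.cost s + (eval s (eq a b)).size

end Expr

/-- Programs. Conditionals and loops treat `nil` as `false` and every other tree as `true`.
`member x e` asks the membership oracle about the example written by `e`, and `equiv x e` asks the
equivalence oracle about the hypothesis written by `e`; the answer is put into register `x`. -/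
inductive Cmd where
  | assign : ℕ → Expr → Cmd
  | seq : Cmd → Cmd → Cmd
  | ite : Expr → Cmd → Cmd → Cmd
  | while : Expr → Cmd → Cmd
  | member : ℕ → Expr → Cmd
  | equiv : ℕ → Expr → Cmd

/-- A configuration of a run: the commands still to be executed, the registers, the time used so
far, and the length of the largest counterexample seen so far (`0` if there was none). -/
structure Config where
  todo : List Cmd
  store : Store
  time : ℕ
  largest : ℕ

/-- One step of computation, for the target `l`. The program is deterministic; the only freedom is
the choice of a counterexample by the equivalence oracle, which may return any one. An oracle call
counts as one step (on top of the evaluation of its argument), and it is possible only on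
the code of an example, respectively of a representation.
The membership oracle answers `cons nil nil` for "yes" and `nil` for "no". The equivalence oracle
answers `nil` for "yes" and `cons (code of e) nil` for the counterexample `e`. -/
inductive Step (F : EncodedFramework) (l : F.Rep) : Config → Config → Prop
  | assign (x : ℕ) (e : Expr) (k : List Cmd) (s : Store) (t m : ℕ) :
      Step F l ⟨Cmd.assign x e :: k, s, t, m⟩
        ⟨k, Function.update s x (e.eval s), t + e.cost s + 1, m⟩
  | seq (c d : Cmd) (k : List Cmd) (s : Store) (t m : ℕ) :
      Step F l ⟨Cmd.seq c d :: k, s, t, m⟩ ⟨c :: d :: k, s, t + 1, m⟩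
  | iteTrue (e : Expr) (c d : Cmd) (k : List Cmd) (s : Store) (t m : ℕ)
      (he : e.eval s ≠ Data.nil) :
      Step F l ⟨Cmd.ite e c d :: k, s, t, m⟩ ⟨c :: k, s, t + e.cost s + 1, m⟩
  | iteFalse (e : Expr) (c d : Cmd) (k : List Cmd) (s : Store) (t m : ℕ)
      (he : e.eval s = Data.nil) :
      Step F l ⟨Cmd.ite e c d :: k, s, t, m⟩ ⟨d :: k, s, t + e.cost s + 1, m⟩
  | whileTrue (e : Expr) (c : Cmd) (k : List Cmd) (s : Store) (t m : ℕ)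
      (he : e.eval s ≠ Data.nil) :
      Step F l ⟨Cmd.while e c :: k, s, t, m⟩ ⟨c :: Cmd.while e c :: k, s, t + e.cost s + 1, m⟩
  | whileFalse (e : Expr) (c : Cmd) (k : List Cmd) (s : Store) (t m : ℕ)
      (he : e.eval s = Data.nil) :
      Step F l ⟨Cmd.while e c :: k, s, t, m⟩ ⟨k, s, t + e.cost s + 1, m⟩
  | memberYes (x : ℕ) (e : Expr) (k : List Cmd) (s : Store) (t m : ℕ) (a : F.Example)
      (ha : e.eval s = F.codeExample a) (hyes : a ∈ F.μ l) :
      Step F l ⟨Cmd.member x e :: k, s, t, m⟩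
        ⟨k, Function.update s x (Data.ofBool true), t + e.cost s + 1, m⟩
  | memberNo (x : ℕ) (e : Expr) (k : List Cmd) (s : Store) (t m : ℕ) (a : F.Example)
      (ha : e.eval s = F.codeExample a) (hno : a ∉ F.μ l) :
      Step F l ⟨Cmd.member x e :: k, s, t, m⟩
        ⟨k, Function.update s x (Data.ofBool false), t + e.cost s + 1, m⟩
  | equivYes (x : ℕ) (e : Expr) (k : List Cmd) (s : Store) (t m : ℕ) (h : F.Rep)
      (hh : e.eval s = F.codeRep h) (hyes : F.μ h = F.μ l) :
      Step F l ⟨Cmd.equiv x e :: k, s, t, m⟩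
        ⟨k, Function.update s x Data.nil, t + e.cost s + 1, m⟩
  | equivNo (x : ℕ) (e : Expr) (k : List Cmd) (s : Store) (t m : ℕ) (h : F.Rep)
      (hh : e.eval s = F.codeRep h) (a : F.Example) (ha : a ∈ symmDiff (F.μ h) (F.μ l)) :
      Step F l ⟨Cmd.equiv x e :: k, s, t, m⟩
        ⟨k, Function.update s x (Data.cons (F.codeExample a) Data.nil), t + e.cost s + 1,
          max m (F.sizeExample a)⟩

/-- The start of a run: register `0` holds `n` in unary, all the others hold `nil`. -/
def Config.init (c : Cmd) (n : ℕ) : Config :=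
  ⟨[c], fun x => if x = 0 then Data.ofList (List.replicate n Data.nil) else Data.nil, 0, 0⟩

/-- `cfg` can occur in a run of the program `c` on input `n` with target `l`. -/
def Reachable (F : EncodedFramework) (l : F.Rep) (c : Cmd) (n : ℕ) (cfg : Config) : Prop :=
  Relation.ReflTransGen (Step F l) (Config.init c n) cfg

/-- On input `n` and for every target `l`, the program `c` halts whatever counterexamples it gets,
and it only stops when it is finished and register `0` holds a representation `l'` with
`μ l' = μ l`. (So it never gets stuck at an oracle call on something that is not a code.) -/
def ExactlyLearns (F : EncodedFramework) (c : Cmd) (n : ℕ) : Prop :=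
  ∀ l : F.Rep,
    (¬ ∃ run : ℕ → Config, run 0 = Config.init c n ∧ ∀ i, Step F l (run i) (run (i + 1))) ∧
    ∀ cfg, Reachable F l c n cfg → (¬ ∃ cfg', Step F l cfg cfg') →
      cfg.todo = [] ∧ ∃ l' : F.Rep, cfg.store 0 = F.codeRep l' ∧ F.μ l' = F.μ l

/-- Polynomial time exact learnability of a family of learning frameworks, the `n`-th of which
speaks about `n` variables: a single program and a single polynomial serve for all `n`. At every
point of every run the time used so far is at most `p (|l|, |e|)`, where `l` is the target and `e`
is the largest counterexample seen so far. -/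
def PolyTimeExactlyLearnable (F : ℕ → EncodedFramework) : Prop :=
  ∃ (c : Cmd) (p : MvPolynomial (Fin 2) ℕ), ∀ n : ℕ,
    ExactlyLearns (F n) c n ∧
    ∀ (l : (F n).Rep) (cfg : Config), Reachable (F n) l c n cfg →
      cfg.time ≤ MvPolynomial.eval ![(F n).sizeRep l, cfg.largest] p

/-! ## Multivalued dependency formulas

The set of variables is `V = Fin n`. -/

/-- An mvd clause `X → Y ∨ Z`, where `X`, `Y`, `Z` are pairwise disjoint and cover `V`. -/
@[ext]
structure MvdClause (n : ℕ) where
  X : Finset (Fin n)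
  Y : Finset (Fin n)
  Z : Finset (Fin n)
  disjoint_XY : Disjoint X Y
  disjoint_XZ : Disjoint X Z
  disjoint_YZ : Disjoint Y Z
  cover : X ∪ Y ∪ Z = Finset.univ

/-- An mvd formula is a conjunction of mvd clauses, written as the list of its conjuncts. -/
abbrev Mvdf (n : ℕ) := List (MvdClause n)

/-- A propositional clause with at most `k` unnegated literals; `neg` holds the variables that
occur negated and `pos` those that occur unnegated. -/
@[ext]
structure QuasiHornClause (k n : ℕ) where
  neg : Finset (Fin n)
  pos : Finset (Fin n)
  card_pos : pos.card ≤ k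

abbrev Interpretation (n : ℕ) := Fin n → Bool

namespace Interpretation

variable {n : ℕ}

def trueSet (I : Interpretation n) : Finset (Fin n) := Finset.univ.filter (fun v => I v = true)

def falseSet (I : Interpretation n) : Finset (Fin n) := Finset.univ.filter (fun v => I v = false)

/-- `I` violates `X → Y ∨ Z` if `X` is true in `I` and one of the following holds: `Y` and `Z` are
non-empty and each of them has a variable that is false in `I`; one of `Y`, `Z` is empty and the
only false variable of `I` is in `Y ∪ Z`; no variable is false in `I` and the clause is `V → F`. -/
def Violates (I : Interpretation n) (c : MvdClause n) : Prop :=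
  c.X ⊆ trueSet I ∧
    ((c.Y.Nonempty ∧ c.Z.Nonempty ∧ ∃ v ∈ c.Y, ∃ w ∈ c.Z, v ∈ falseSet I ∧ w ∈ falseSet I) ∨
      ((c.Y = ∅ ∨ c.Z = ∅) ∧ ∃ v ∈ c.Y ∪ c.Z, falseSet I = {v}) ∨
      (falseSet I = ∅ ∧ c.X = Finset.univ ∧ c.Y = ∅ ∧ c.Z = ∅))

/-- `I ⊨ T` for an mvd formula `T`. -/
def Models (I : Interpretation n) (T : Mvdf n) : Prop := ∀ c ∈ T, ¬ Violates I c

/-- `I ⊨ e` for a propositional clause `e`. -/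
def Satisfies {k : ℕ} (I : Interpretation n) (e : QuasiHornClause k n) : Prop :=
  (∃ v ∈ e.neg, I v = false) ∨ ∃ v ∈ e.pos, I v = true

end Interpretation

/-- `T ⊨ e`. -/
def Mvdf.Entails {k n : ℕ} (T : Mvdf n) (e : QuasiHornClause k n) : Prop :=
  ∀ I : Interpretation n, I.Models T → I.Satisfies e

/-- A set of variables is written as its characteristic vector. -/
def codeSet {n : ℕ} (s : Finset (Fin n)) : Data :=
  Data.ofList ((List.finRange n).map (fun v => Data.ofBool (decide (v ∈ s))))

theorem codeSet_injective {n : ℕ} : Function.Injective (codeSet (n := n)) := by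
  intro s t h
  have h1 := Data.ofList_injective h
  ext v
  have h2 := (List.map_inj_left.mp h1) v (List.mem_finRange v)
  have h3 := Data.ofBool_injective h2
  simpa using h3

def MvdClause.code {n : ℕ} (c : MvdClause n) : Data :=
  Data.cons (codeSet c.X) (Data.cons (codeSet c.Y) (codeSet c.Z))

theorem MvdClause.code_injective {n : ℕ} : Function.Injective (MvdClause.code (n := n)) := by
  intro c d h
  simp only [MvdClause.code, Data.cons.injEq] at h
  exact MvdClause.ext (codeSet_injective h.1) (codeSet_injective h.2.1) (codeSet_injective h.2.2)

def Mvdf.code {n : ℕ} (T : Mvdf n) : Data := Data.ofList (T.map MvdClause.code)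

theorem Mvdf.code_injective {n : ℕ} : Function.Injective (Mvdf.code (n := n)) :=
  Data.ofList_injective.comp (List.map_injective_iff.mpr MvdClause.code_injective)

def QuasiHornClause.code {k n : ℕ} (e : QuasiHornClause k n) : Data :=
  Data.cons (codeSet e.neg) (codeSet e.pos)

theorem QuasiHornClause.code_injective {k n : ℕ} :
    Function.Injective (QuasiHornClause.code (k := k) (n := n)) := by
  intro c d h
  simp only [QuasiHornClause.code, Data.cons.injEq] at h
  exact QuasiHornClause.ext (codeSet_injective h.1) (codeSet_injective h.2)

/-- Learning mvd formulas from 2-quasi-Horn clauses, over `n` variables: the examples are the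
2-quasi-Horn clauses, the representations are the mvd formulas, and `T` denotes the set of the
2-quasi-Horn clauses that it entails. -/
def mvdfFromQuasiHorn (n : ℕ) : EncodedFramework where
  Example := QuasiHornClause 2 n
  Rep := Mvdf n
  μ T := {e | T.Entails e}
  codeExample := QuasiHornClause.code
  codeExample_injective := QuasiHornClause.code_injective
  codeRep := Mvdf.code
  codeRep_injective := Mvdf.code_injective

end ExactLearning

/-! Identify an interpretation with the set `F` of its false variables. A clause of the target `T`
with both parts non-empty forbids exactly the sets `F ⊆ Y ∪ Z` that meet both `Y` and `Z`. Hence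
models of `T` that share a false variable are closed under union (`Sat.union`). For `y ∈ G`, the
models `F` with `y ∈ F ⊆ G` therefore have a greatest element if there are any; it is `block T y G`,
and membership queries for `V \ G → y ∨ z` compute it. A set `G` with at least two elements is a
model iff its block is `G` (`Sat.block_eq`, `sat_of_block_eq`). In any case a model inside `G` lies
within the block or avoids it (`Sat.subset_block`), so a proper block yields a consequence of `T`,
the clause that splits `G` into the block and the rest.

The hypothesis consists of such clauses, one for each record `(y, G)`, and of clauses that settle
the interpretations with at most one false variable. It follows from `T`, so every counterexample
`e` is entailed by `T` but not by the hypothesis. Let `E` be a model of the hypothesis that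
falsifies `e`, and let `y ∈ E`. Cutting the complement of `e.neg` down by the records for `y` leaves
a set that still contains `E`, hence falsifies `e` and is no model of `T`: its block is proper, and
there is something to record (`weight_lt_learn_of_counterexample`).

As in Horn learning, the new set is merged into an old record where possible, and otherwise becomes
a record of its own. The invariant makes it possible to assign to each record a clause of `T`
crossed by its set, so that records for the same variable get different clauses
(`Invariant.length_le`). So there are at most `n * |T|` records, and the sum of the sizes of their
sets, which grows with each counterexample, is polynomially bounded.

The running time is handled by closure properties of `PolyTime`, functions computed with membership
queries. Time depending on `n` can be charged only once a counterexample, of length at least `n`,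
has been seen; this is why the first query is about the empty formula. -/

open Polynomial

namespace ExactLearning

/-! ## Safe configurations and big-step execution -/

/-- From `cfg`, every run stays within the time bound, terminates, and ends in a finished
configuration whose registers satisfy `Post`. -/
inductive Safe (F : EncodedFramework) (l : F.Rep) (bound : ℕ → ℕ) (Post : Store → Prop) :
    Config → Prop
  | intro (cfg : Config) (time : cfg.time ≤ bound cfg.largest)
      (stuck : (¬ ∃ cfg', Step F l cfg cfg') → cfg.todo = [] ∧ Post cfg.store)
      (next : ∀ cfg', Step F l cfg cfg' → Safe F l bound Post cfg') : Safe F l bound Post cfg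

namespace Safe

variable {F : EncodedFramework} {l : F.Rep} {bound : ℕ → ℕ} {Post : Store → Prop} {cfg : Config}

theorem time_le (h : Safe F l bound Post cfg) : cfg.time ≤ bound cfg.largest := by
  cases h; assumption

theorem post (h : Safe F l bound Post cfg) (hs : ¬ ∃ cfg', Step F l cfg cfg') :
    cfg.todo = [] ∧ Post cfg.store := by
  cases h with
  | intro _ _ stuck _ => exact stuck hs

theorem of_step {cfg' : Config} (h : Safe F l bound Post cfg) (hs : Step F l cfg cfg') :
    Safe F l bound Post cfg' := by
  cases h with
  | intro _ _ _ next => exact next _ hs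

theorem of_reachable {cfg' : Config} (h : Safe F l bound Post cfg)
    (hr : Relation.ReflTransGen (Step F l) cfg cfg') : Safe F l bound Post cfg' := by
  induction hr with
  | refl => exact h
  | tail _ hs ih => exact ih.of_step hs

theorem no_infinite_run (h : Safe F l bound Post cfg) :
    ¬ ∃ run : ℕ → Config, run 0 = cfg ∧ ∀ i, Step F l (run i) (run (i + 1)) := by
  induction h with
  | intro cfg _ _ _ ih =>
    rintro ⟨run, h0, hs⟩
    exact ih (run 1) (h0 ▸ hs 0) ⟨fun i => run (i + 1), rfl, fun i => hs (i + 1)⟩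

theorem done {s : Store} {t m : ℕ} (ht : t ≤ bound m) (hp : Post s) :
    Safe F l bound Post ⟨[], s, t, m⟩ :=
  .intro _ ht (fun _ => ⟨rfl, hp⟩) (fun _ h => nomatch h)

/-- Runs branch only at equivalence queries; every other command is covered by this lemma. -/
theorem of_unique {cfg' : Config} (ht : cfg.time ≤ bound cfg.largest) (hs : Step F l cfg cfg')
    (hu : ∀ c, Step F l cfg c → c = cfg') (h : Safe F l bound Post cfg') :
    Safe F l bound Post cfg :=
  .intro _ ht (fun hn => absurd ⟨_, hs⟩ hn) (fun c hc => hu c hc ▸ h)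

theorem seq {c d : Cmd} {k : List Cmd} {s : Store} {t m : ℕ}
    (h : Safe F l bound Post ⟨c :: d :: k, s, t + 1, m⟩) :
    Safe F l bound Post ⟨Cmd.seq c d :: k, s, t, m⟩ := by
  have := h.time_le
  refine of_unique (by simp at this ⊢; omega) (.seq c d k s t m) (fun c hc => ?_) h
  cases hc; rfl

theorem ite {e : Expr} {c d : Cmd} {k : List Cmd} {s : Store} {t m : ℕ}
    (h : Safe F l bound Post
      ⟨(if e.eval s = Data.nil then d else c) :: k, s, t + e.cost s + 1, m⟩) :
    Safe F l bound Post ⟨Cmd.ite e c d :: k, s, t, m⟩ := by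
  have := h.time_le
  by_cases he : e.eval s = Data.nil
  · rw [if_pos he] at h
    refine of_unique (by simp at this ⊢; omega) (.iteFalse e c d k s t m he) (fun c hc => ?_) h
    cases hc
    · contradiction
    · rfl
  · rw [if_neg he] at h
    refine of_unique (by simp at this ⊢; omega) (.iteTrue e c d k s t m he) (fun c hc => ?_) h
    cases hc
    · rfl
    · contradiction

theorem whileTrue {e : Expr} {c : Cmd} {k : List Cmd} {s : Store} {t m : ℕ}
    (he : e.eval s ≠ Data.nil)
    (h : Safe F l bound Post ⟨c :: Cmd.while e c :: k, s, t + e.cost s + 1, m⟩) :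
    Safe F l bound Post ⟨Cmd.while e c :: k, s, t, m⟩ := by
  have := h.time_le
  refine of_unique (by simp at this ⊢; omega) (.whileTrue e c k s t m he) (fun c hc => ?_) h
  cases hc
  · rfl
  · contradiction

theorem whileFalse {e : Expr} {c : Cmd} {k : List Cmd} {s : Store} {t m : ℕ}
    (he : e.eval s = Data.nil)
    (h : Safe F l bound Post ⟨k, s, t + e.cost s + 1, m⟩) :
    Safe F l bound Post ⟨Cmd.while e c :: k, s, t, m⟩ := by
  have := h.time_le
  refine of_unique (by simp at this ⊢; omega) (.whileFalse e c k s t m he) (fun c hc => ?_) h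
  cases hc
  · contradiction
  · rfl

theorem assign {x : ℕ} {e : Expr} {k : List Cmd} {s : Store} {t m : ℕ}
    (h : Safe F l bound Post ⟨k, Function.update s x (e.eval s), t + e.cost s + 1, m⟩) :
    Safe F l bound Post ⟨Cmd.assign x e :: k, s, t, m⟩ := by
  have := h.time_le
  refine of_unique (by simp at this ⊢; omega) (.assign x e k s t m) (fun c hc => ?_) h
  cases hc; rfl

/-- A counterexample may raise `largest`, and with it the bound, so the time bound at the query does
not follow from the one afterwards and is the separate hypothesis `ht`. -/
theorem equiv {x : ℕ} {e : Expr} {k : List Cmd} {s : Store} {t m : ℕ} (h : F.Rep)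
    (hh : e.eval s = F.codeRep h) (ht : t ≤ bound m)
    (hyes : F.μ h = F.μ l →
      Safe F l bound Post ⟨k, Function.update s x Data.nil, t + e.cost s + 1, m⟩)
    (hno : ∀ a ∈ symmDiff (F.μ h) (F.μ l), Safe F l bound Post
      ⟨k, Function.update s x (Data.cons (F.codeExample a) Data.nil), t + e.cost s + 1,
        max m (F.sizeExample a)⟩) :
    Safe F l bound Post ⟨Cmd.equiv x e :: k, s, t, m⟩ := by
  refine .intro _ ht (fun hn => absurd ?_ hn) (fun c hc => ?_)
  · by_cases hy : F.μ h = F.μ l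
    · exact ⟨_, .equivYes x e k s t m h hh hy⟩
    · obtain ⟨a, ha⟩ := Set.symmDiff_nonempty.mpr hy
      exact ⟨_, .equivNo x e k s t m h hh a ha⟩
  · cases hc with
    | equivYes _ _ _ _ _ _ h' hh' hy =>
      obtain rfl := F.codeRep_injective (hh.symm.trans hh')
      exact hyes hy
    | equivNo _ _ _ _ _ _ h' hh' a ha =>
      obtain rfl := F.codeRep_injective (hh.symm.trans hh')
      exact hno a ha

end Safe

open Classical in
/-- Big-step execution, with its time, of programs that do not ask equivalence queries. -/
inductive BigStep (F : EncodedFramework) (l : F.Rep) : Cmd → Store → Store → ℕ → Prop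
  | assign (x : ℕ) (e : Expr) (s : Store) :
      BigStep F l (.assign x e) s (Function.update s x (e.eval s)) (e.cost s + 1)
  | seq {c d : Cmd} {s s' s'' : Store} {i j : ℕ} (hc : BigStep F l c s s' i)
      (hd : BigStep F l d s' s'' j) : BigStep F l (.seq c d) s s'' (i + j + 1)
  | ite {e : Expr} {c d : Cmd} {s s' : Store} {i : ℕ}
      (h : BigStep F l (if e.eval s = Data.nil then d else c) s s' i) :
      BigStep F l (.ite e c d) s s' (e.cost s + i + 1)
  | whileTrue {e : Expr} {c : Cmd} {s s' s'' : Store} {i j : ℕ} (he : e.eval s ≠ Data.nil)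
      (hc : BigStep F l c s s' i) (hw : BigStep F l (.while e c) s' s'' j) :
      BigStep F l (.while e c) s s'' (e.cost s + i + j + 1)
  | whileFalse {e : Expr} {c : Cmd} {s : Store} (he : e.eval s = Data.nil) :
      BigStep F l (.while e c) s s (e.cost s + 1)
  | member (x : ℕ) {e : Expr} {s : Store} (a : F.Example) (ha : e.eval s = F.codeExample a) :
      BigStep F l (.member x e) s
        (Function.update s x (Data.ofBool (decide (a ∈ F.μ l)))) (e.cost s + 1)

/-- Without equivalence queries `largest` stays fixed while time grows, so the bound at the end of
the execution implies it at every intermediate step. -/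
theorem BigStep.safe {F : EncodedFramework} {l : F.Rep} {bound : ℕ → ℕ} {Post : Store → Prop}
    {c : Cmd} {s s' : Store} {i : ℕ} (h : BigStep F l c s s' i) {k : List Cmd} {t m : ℕ}
    (hs : Safe F l bound Post ⟨k, s', t + i, m⟩) : Safe F l bound Post ⟨c :: k, s, t, m⟩ := by
  induction h generalizing k t with
  | assign x e s => exact .assign hs
  | @seq c d s s' s'' i j _ _ ihc ihd =>
    refine .seq (ihc (ihd ?_))
    rwa [show t + 1 + i + j = t + (i + j + 1) by omega]
  | @ite e c d s s' i _ ih =>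
    refine .ite (ih ?_)
    rwa [show t + e.cost s + 1 + i = t + (e.cost s + i + 1) by omega]
  | @whileTrue e c s s' s'' i j he _ _ ihc ihw =>
    refine .whileTrue he (ihc (ihw ?_))
    rwa [show t + e.cost s + 1 + i + j = t + (e.cost s + i + j + 1) by omega]
  | whileFalse he => exact .whileFalse he hs
  | @member x e s a ha =>
    have := hs.time_le
    by_cases hy : a ∈ F.μ l
    · simp only [hy, decide_true] at hs
      refine .of_unique (by simp at this ⊢; omega) (.memberYes x e k s t m a ha hy)
        (fun c hc => ?_) hs
      cases hc with
      | memberYes => rfl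
      | memberNo _ _ _ _ _ _ a' ha' hno =>
        obtain rfl := F.codeExample_injective (ha.symm.trans ha')
        contradiction
    · simp only [hy, decide_false] at hs
      refine .of_unique (by simp at this ⊢; omega) (.memberNo x e k s t m a ha hy)
        (fun c hc => ?_) hs
      cases hc with
      | memberNo => rfl
      | memberYes _ _ _ _ _ _ a' ha' hyes =>
        obtain rfl := F.codeExample_injective (ha.symm.trans ha')
        contradiction

/-! ## Polynomial-time functions -/

theorem Data.size_pos (d : Data) : 0 < d.size := by
  cases d <;> simp [Data.size]

theorem Expr.size_eval_le_cost (s : Store) (e : Expr) : (e.eval s).size ≤ e.cost s := by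
  cases e <;> simp [Expr.eval, Expr.cost, Data.size]

theorem eval_le_eval (p : ℕ[X]) {a b : ℕ} (h : a ≤ b) : p.eval a ≤ p.eval b := by
  rw [eval_eq_sum_range, eval_eq_sum_range]
  gcongr

/-- Types whose elements are written as trees. -/
class Code (α : Type) where
  code : α → Data

open Code (code)

/-- The length of the code. -/
def codeSize {α : Type} [Code α] (a : α) : ℕ := (code a).size

theorem codeSize_pos {α : Type} [Code α] (a : α) : 0 < codeSize a := Data.size_pos _

instance : Code Bool := ⟨Data.ofBool⟩
instance {α β : Type} [Code α] [Code β] : Code (α × β) := ⟨fun a => .cons (code a.1) (code a.2)⟩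
instance {α : Type} [Code α] : Code (List α) := ⟨fun l => Data.ofList (l.map code)⟩
instance {n : ℕ} : Code (Finset (Fin n)) := ⟨codeSet⟩
/-- A variable is written as the singleton that contains it. -/
instance {n : ℕ} : Code (Fin n) := ⟨fun v => codeSet {v}⟩
instance {n : ℕ} : Code (MvdClause n) := ⟨MvdClause.code⟩
instance {k n : ℕ} : Code (QuasiHornClause k n) := ⟨QuasiHornClause.code⟩

section Code

variable {α β : Type} [Code α] [Code β]

@[simp] theorem code_pair (a : α) (b : β) : code (a, b) = .cons (code a) (code b) := rfl
@[simp] theorem code_nil : code ([] : List α) = .nil := rfl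
@[simp] theorem code_cons (a : α) (l : List α) : code (a :: l) = .cons (code a) (code l) := rfl
@[simp] theorem code_false : code false = .nil := rfl
@[simp] theorem code_true : code true = .cons .nil .nil := rfl

@[simp] theorem codeSize_pair (a : α) (b : β) :
    codeSize (a, b) = codeSize a + codeSize b + 1 := rfl
@[simp] theorem codeSize_nil : codeSize ([] : List α) = 1 := rfl
@[simp] theorem codeSize_cons (a : α) (l : List α) :
    codeSize (a :: l) = codeSize a + codeSize l + 1 := rfl

theorem codeSize_bool_le (b : Bool) : codeSize b ≤ 3 := by
  cases b <;> decide

theorem codeSize_le_of_mem {a : α} {l : List α} (h : a ∈ l) : codeSize a ≤ codeSize l := by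
  induction l with
  | nil => simp at h
  | cons b l ih =>
    rcases List.mem_cons.mp h with rfl | h
    · simp; omega
    · have := ih h
      simp; omega

theorem length_le_codeSize (l : List α) : l.length ≤ codeSize l := by
  induction l with
  | nil => simp
  | cons b l ih => simp; omega

end Code

/-- Families of functions, indexed by the number of variables and the target, that are computed by
a single program in polynomial time. The program finds its argument in register `r`, leaves the
value there, and does not change the registers before `r`. -/
def PolyTime {α β : ℕ → Type} [∀ n, Code (α n)] [∀ n, Code (β n)]
    (f : ∀ n, Mvdf n → α n → β n) : Prop :=
  ∃ p : ℕ[X], (∀ n T a, codeSize (f n T a) ≤ p.eval (codeSize a)) ∧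
    ∀ r : ℕ, ∃ c : Cmd, ∀ (n : ℕ) (T : Mvdf n) (a : α n) (s : Store), s r = code a → ∃ s' i,
      BigStep (mvdfFromQuasiHorn n) T c s s' i ∧ s' r = code (f n T a) ∧
        (∀ x < r, s' x = s x) ∧ i ≤ p.eval (codeSize a)

namespace PolyTime

variable {α β γ δ : ℕ → Type} [∀ n, Code (α n)] [∀ n, Code (β n)] [∀ n, Code (γ n)]
  [∀ n, Code (δ n)]

theorem congr {f : ∀ n, Mvdf n → α n → β n} {g : ∀ n, Mvdf n → α n → γ n} (hf : PolyTime f)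
    (h : ∀ n T a, code (g n T a) = code (f n T a)) : PolyTime g := by
  obtain ⟨p, hp, hc⟩ := hf
  refine ⟨p, fun n T a => ?_, fun r => ?_⟩
  · rw [codeSize, h]; exact hp n T a
  · simp only [h]; exact hc r

theorem of_expr {f : ∀ n, Mvdf n → α n → β n} (e : ℕ → Expr) (p : ℕ[X])
    (h : ∀ n T a r (s : Store), s r = code a → (e r).eval s = code (f n T a) ∧
      (e r).cost s ≤ p.eval (codeSize a)) : PolyTime f := by
  refine ⟨p + 1, fun n T a => ?_, fun r => ⟨.assign r (e r), fun n T a s hs => ?_⟩⟩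
  · obtain ⟨h1, h2⟩ := h n T a 0 (fun _ => code a) rfl
    have h3 := Expr.size_eval_le_cost (fun _ => code a) (e 0)
    rw [h1] at h3
    simp only [eval_add, eval_one, codeSize] at h2 ⊢
    omega
  · obtain ⟨h1, h2⟩ := h n T a r s hs
    refine ⟨_, _, .assign r (e r) s, ?_, ?_, ?_⟩
    · simpa using h1
    · intro x hx
      simp [hx.ne]
    · simpa using h2

protected theorem id : PolyTime (fun n _ (a : α n) => a) :=
  of_expr (fun r => .reg r) X fun n T a r s hs => by simp [Expr.eval, Expr.cost, hs, codeSize]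

theorem const_nil {f : ∀ n, Mvdf n → α n → β n} (h : ∀ n T a, code (f n T a) = .nil) :
    PolyTime f :=
  of_expr (fun _ => .nil) 1 fun n T a r s hs => by simp [Expr.eval, Expr.cost, h]

theorem const_bool (b : Bool) : PolyTime (fun n _ (_ : α n) => b) := by
  cases b
  · exact const_nil fun _ _ _ => rfl
  · exact of_expr (fun _ => .cons .nil .nil) 5 fun n T a r s hs => by
      simp [Expr.eval, Expr.cost, Data.size]

theorem comp {g : ∀ n, Mvdf n → β n → γ n} {f : ∀ n, Mvdf n → α n → β n} (hg : PolyTime g)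
    (hf : PolyTime f) : PolyTime (fun n T a => g n T (f n T a)) := by
  obtain ⟨p, hp, hc⟩ := hf
  obtain ⟨q, hq, hd⟩ := hg
  refine ⟨p + q.comp p + 1, fun n T a => ?_, fun r => ?_⟩
  · have := eval_le_eval q (hp n T a)
    have := hq n T (f n T a)
    simp only [eval_add, eval_comp, eval_one]
    omega
  · obtain ⟨c, hc⟩ := hc r
    obtain ⟨d, hd⟩ := hd r
    refine ⟨.seq c d, fun n T a s hs => ?_⟩
    obtain ⟨s1, i, hb1, hs1, hx1, hi⟩ := hc n T a s hs
    obtain ⟨s2, j, hb2, hs2, hx2, hj⟩ := hd n T _ s1 hs1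
    refine ⟨s2, _, .seq hb1 hb2, hs2, fun x hx => (hx2 x hx).trans (hx1 x hx), ?_⟩
    have := eval_le_eval q (hp n T a)
    simp only [eval_add, eval_comp, eval_one]
    omega

theorem fst {f : ∀ n, Mvdf n → α n → β n × γ n} (hf : PolyTime f) :
    PolyTime (fun n T a => (f n T a).1) :=
  comp (g := fun n _ (a : β n × γ n) => a.1) (of_expr (fun r => .head (.reg r)) (2 * X)
    fun n T a r s hs => by
      simp [Expr.eval, Expr.cost, hs, codeSize, code, Data.head, Data.size]
      omega) hf

theorem snd {f : ∀ n, Mvdf n → α n → β n × γ n} (hf : PolyTime f) :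
    PolyTime (fun n T a => (f n T a).2) :=
  comp (g := fun n _ (a : β n × γ n) => a.2) (of_expr (fun r => .tail (.reg r)) (2 * X)
    fun n T a r s hs => by
      simp [Expr.eval, Expr.cost, hs, codeSize, code, Data.tail, Data.size]
      omega) hf

theorem pair {f : ∀ n, Mvdf n → α n → β n} {g : ∀ n, Mvdf n → α n → γ n} (hf : PolyTime f)
    (hg : PolyTime g) : PolyTime (fun n T a => (f n T a, g n T a)) := by
  obtain ⟨p, hp, hc⟩ := hf
  obtain ⟨q, hq, hd⟩ := hg
  refine ⟨3 * p + 3 * q + 2 * X + 10, fun n T a => ?_, fun r => ?_⟩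
  · have := hp n T a
    have := hq n T a
    simp
    omega
  · obtain ⟨c, hc⟩ := hc (r + 1)
    obtain ⟨d, hd⟩ := hd (r + 2)
    -- The second program works from register `r + 2` on, so it preserves the first result in `r +
    -- 1`.
    refine ⟨.seq (.assign (r + 1) (.reg r)) (.seq c (.seq (.assign (r + 2) (.reg r)) (.seq d
      (.assign r (.cons (.reg (r + 1)) (.reg (r + 2))))))), fun n T a s hs => ?_⟩
    obtain ⟨s1, i, hb1, hs1, hx1, hi⟩ := hc n T a (Function.update s (r + 1) (s r)) (by simp [hs])
    have h1r : s1 r = code a := by rw [hx1 r (by omega)]; simp [hs]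
    obtain ⟨s2, j, hb2, hs2, hx2, hj⟩ := hd n T a (Function.update s1 (r + 2) (s1 r))
      (by simp [h1r])
    have h2r : s2 (r + 1) = code (f n T a) := by rw [hx2 _ (by omega)]; simp [hs1]
    refine ⟨_, _, .seq (.assign _ _ _) (.seq hb1 (.seq (.assign _ _ _) (.seq hb2
      (.assign _ _ _)))), ?_, ?_, ?_⟩
    · simp [Expr.eval, hs2, h2r]
    · intro x hx
      rw [Function.update_of_ne (by omega), hx2 x (by omega), Function.update_of_ne (by omega),
        hx1 x (by omega), Function.update_of_ne (by omega)]
    · have := hp n T a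
      have := hq n T a
      simp only [codeSize] at *
      simp [Expr.cost, Expr.eval, hs, hs2, h1r, h2r, Data.size]
      omega

theorem ite {b : ∀ n, Mvdf n → α n → Bool} {f g : ∀ n, Mvdf n → α n → β n} (hb : PolyTime b)
    (hf : PolyTime f) (hg : PolyTime g) :
    PolyTime (fun n T a => if b n T a = true then f n T a else g n T a) := by
  obtain ⟨o, ho, hb⟩ := hb
  obtain ⟨p, hp, hc⟩ := hf
  obtain ⟨q, hq, hd⟩ := hg
  refine ⟨2 * o + p + q + X + 10, fun n T a => ?_, fun r => ?_⟩
  · have := hp n T a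
    have := hq n T a
    dsimp only
    split <;> simp <;> omega
  · obtain ⟨b', hb⟩ := hb (r + 1)
    obtain ⟨c, hc⟩ := hc r
    obtain ⟨d, hd⟩ := hd r
    refine ⟨.seq (.assign (r + 1) (.reg r)) (.seq b' (.ite (.reg (r + 1)) c d)),
      fun n T a s hs => ?_⟩
    obtain ⟨s1, i, hb1, hs1, hx1, hi⟩ := hb n T a (Function.update s (r + 1) (s r)) (by simp [hs])
    have h1r : s1 r = code a := by rw [hx1 r (by omega)]; simp [hs]
    have hsz := ho n T a
    have hx1' : ∀ x < r, s1 x = s x := fun x hx => by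
      rw [hx1 x (by omega), Function.update_of_ne (by omega)]
    cases hbv : b n T a with
    | true =>
      obtain ⟨s2, j, hb2, hs2, hx2, hj⟩ := hc n T a s1 h1r
      refine ⟨s2, _, .seq (.assign _ _ _) (.seq hb1 (.ite (i := j) ?_)), ?_, ?_, ?_⟩
      · simpa [Expr.eval, hs1, hbv] using hb2
      · simp [hs2, hbv]
      · exact fun x hx => (hx2 x hx).trans (hx1' x hx)
      · simp only [codeSize] at *
        simp [Expr.cost, hs, hs1]
        omega
    | false =>
      obtain ⟨s2, j, hb2, hs2, hx2, hj⟩ := hd n T a s1 h1r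
      refine ⟨s2, _, .seq (.assign _ _ _) (.seq hb1 (.ite (i := j) ?_)), ?_, ?_, ?_⟩
      · simpa [Expr.eval, hs1, hbv] using hb2
      · simp [hs2, hbv]
      · exact fun x hx => (hx2 x hx).trans (hx1' x hx)
      · simp only [codeSize] at *
        simp [Expr.cost, hs, hs1]
        omega

theorem beq [∀ n, DecidableEq (β n)] {f g : ∀ n, Mvdf n → α n → β n} (hf : PolyTime f)
    (hg : PolyTime g) (hinj : ∀ n, Function.Injective (code : β n → Data)) :
    PolyTime (fun n T a => decide (f n T a = g n T a)) := by
  refine comp (g := fun n _ (a : β n × β n) => decide (a.1 = a.2)) ?_ (hf.pair hg)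
  refine of_expr (fun r => .eq (.head (.reg r)) (.tail (.reg r))) (4 * X + 3)
    fun n T a r s hs => ?_
  obtain ⟨a, b⟩ := a
  have h1 : code (decide (code a = code b)) = code (decide (a = b)) := by
    simp only [(hinj n).eq_iff]
  have h2 := codeSize_bool_le (decide (code a = code b))
  refine ⟨by simpa [Expr.eval, hs, Data.head, Data.tail, code] using h1, ?_⟩
  simp only [codeSize, code] at h2 ⊢
  simp [Expr.eval, Expr.cost, hs, code, Data.head, Data.tail, Data.size] at h2 ⊢
  omega

-- The only primitive that consults the target; everything else learns about `T` through it.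
open Classical in
theorem member : PolyTime (fun n T (e : QuasiHornClause 2 n) => decide (T.Entails e)) := by
  refine ⟨X + 3, fun n T a => (codeSize_bool_le _).trans (by simp), fun r =>
    ⟨.member r (.reg r), fun n T a s hs => ?_⟩⟩
  refine ⟨_, _, .member r (F := mvdfFromQuasiHorn n) (l := T) a hs, ?_, ?_, ?_⟩
  · simp; rfl
  · intro x hx
    simp [hx.ne]
  · simp [Expr.cost, hs, codeSize]

/-- Iterating a polynomial-time step can blow up the accumulator, so a polynomial bound on it after
every prefix is required. -/
theorem foldl {f : ∀ n, Mvdf n → α n × (β n × γ n) → γ n} {l : ∀ n, Mvdf n → α n → List (β n)}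
    {b : ∀ n, Mvdf n → α n → γ n} (hf : PolyTime f) (hl : PolyTime l) (hb : PolyTime b)
    (o : ℕ[X]) (ho : ∀ n T a t, t <+: l n T a →
      codeSize (t.foldl (fun y x => f n T (a, x, y)) (b n T a)) ≤ o.eval (codeSize a)) :
    PolyTime (fun n T a => (l n T a).foldl (fun y x => f n T (a, x, y)) (b n T a)) := by
  obtain ⟨q, hq, hf⟩ := hf
  obtain ⟨pl, hpl, hl⟩ := hl
  obtain ⟨pb, hpb, hb⟩ := hb
  -- `w` bounds the size of the triple passed to `f`; the `2` counts its two pairing nodes.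
  set w : ℕ[X] := X + pl + o + 2 with hw
  set step : ℕ[X] := q.comp w + 10 * w + 20 with hstep
  refine ⟨pl + pb + 2 * X + pl * step + pl + o + 20, fun n T a => ?_, fun r => ?_⟩
  · refine (ho n T a _ List.prefix_rfl).trans ?_
    simp only [eval_add]
    omega
  obtain ⟨cl, hl⟩ := hl (r + 1)
  obtain ⟨cb, hb⟩ := hb (r + 2)
  obtain ⟨cf, hf⟩ := hf (r + 3)
  -- Register `r` keeps the argument, `r + 1` the rest of the list, `r + 2` the accumulator; `f` is
  -- evaluated in `r + 3`.
  set body : Cmd := .seq (.assign (r + 3) (.cons (.reg r) (.cons (.head (.reg (r + 1)))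
    (.reg (r + 2))))) (.seq cf (.seq (.assign (r + 2) (.reg (r + 3)))
    (.assign (r + 1) (.tail (.reg (r + 1)))))) with hbody
  refine ⟨.seq (.assign (r + 1) (.reg r)) (.seq cl (.seq (.assign (r + 2) (.reg r)) (.seq cb
      (.seq (.while (.reg (r + 1)) body) (.assign r (.reg (r + 2))))))), fun n T a s hs => ?_⟩
  have loop : ∀ (t2 t1 : List (β n)) (s : Store), t1 ++ t2 = l n T a → s r = code a →
      s (r + 1) = code t2 →
      s (r + 2) = code (t1.foldl (fun y x => f n T (a, x, y)) (b n T a)) →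
      ∃ s' i, BigStep (mvdfFromQuasiHorn n) T (.while (.reg (r + 1)) body) s s' i ∧
        s' (r + 2) = code ((l n T a).foldl (fun y x => f n T (a, x, y)) (b n T a)) ∧
        (∀ x < r, s' x = s x) ∧ i ≤ t2.length * step.eval (codeSize a) + 2 := by
    intro t2
    induction t2 with
    | nil =>
      intro t1 s ht hr h1 h2
      refine ⟨s, _, .whileFalse (by simpa [Expr.eval] using h1), ?_, fun _ _ => rfl, ?_⟩
      · rw [h2, ← ht, List.append_nil]
      · simp [Expr.cost, h1, Data.size]
    | cons x t2 ih =>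
      intro t1 s ht hr h1 h2
      set y := t1.foldl (fun y x => f n T (a, x, y)) (b n T a) with hy
      obtain ⟨s1, i, hb1, hs1, hx1, hi⟩ := hf n T (a, x, y)
        (Function.update s (r + 3) (.cons (s r) (.cons (s (r + 1)).head (s (r + 2)))))
        (by simp [hr, h1, h2, Data.head])
      have e1 : s1 r = s r := by rw [hx1 r (by omega)]; simp
      have e2 : s1 (r + 1) = s (r + 1) := by rw [hx1 _ (by omega)]; simp
      obtain ⟨s2, j, hb2, hs2, hx2, hj⟩ := ih (t1 ++ [x])
        (Function.update (Function.update s1 (r + 2) (s1 (r + 3))) (r + 1) (s1 (r + 1)).tail)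
        (by simpa using ht) (by simp [e1, hr]) (by simp [e2, h1, Data.tail])
        (by simp [hs1, hy])
      refine ⟨s2, _, .whileTrue (by simp [Expr.eval, h1]) (.seq (.assign _ _ _) (.seq hb1
        (.seq (.assign _ _ _) (.assign _ _ _)))) (j := j) (by simpa [Expr.eval] using hb2),
        hs2, ?_, ?_⟩
      · intro x hx
        rw [hx2 x hx, Function.update_of_ne (by omega), Function.update_of_ne (by omega),
          hx1 x (by omega), Function.update_of_ne (by omega)]
      · have k1 : codeSize y ≤ o.eval (codeSize a) := ho n T a t1 ⟨_, ht⟩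
        have k2 : codeSize (x :: t2) ≤ codeSize (l n T a) := by
          rw [← ht]
          clear ht hy k1 hs1 hi hb1 h2 ih
          induction t1 with
          | nil => simp
          | cons z t1 ih => rw [List.cons_append, codeSize_cons z]; omega
        have k3 := hpl n T a
        have k4 : codeSize (f n T (a, x, y)) ≤ o.eval (codeSize a) := by
          have := ho n T a (t1 ++ [x]) ⟨t2, by simpa using ht⟩
          simpa [hy] using this
        have k5 : codeSize (a, x, y) ≤ w.eval (codeSize a) := by
          simp [hw] at k2 ⊢
          omega
        have k6 := eval_le_eval q k5
        have k7 : (step.eval (codeSize a)) =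
          q.eval (w.eval (codeSize a)) + 10 * w.eval (codeSize a) + 20 := by simp [hstep]
        have k8 : w.eval (codeSize a) =
          codeSize a + pl.eval (codeSize a) + o.eval (codeSize a) + 2 := by simp [hw]
        rw [List.length_cons, Nat.succ_mul]
        simp only [codeSize_cons] at k2
        simp only [codeSize] at *
        simp [Expr.eval, Expr.cost, hr, h1, h2, e2, hs1, Data.head, Data.tail, Data.size]
        omega
  obtain ⟨s1, i1, hb1, hs1, hx1, hi1⟩ := hl n T a (Function.update s (r + 1) (s r)) (by simp [hs])
  have h1r : s1 r = code a := by rw [hx1 r (by omega)]; simp [hs]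
  obtain ⟨s2, i2, hb2, hs2, hx2, hi2⟩ := hb n T a (Function.update s1 (r + 2) (s1 r))
    (by simp [h1r])
  have h2r : s2 r = code a := by rw [hx2 r (by omega)]; simp [h1r]
  have h2r1 : s2 (r + 1) = code (l n T a) := by rw [hx2 _ (by omega)]; simp [hs1]
  obtain ⟨s3, i3, hb3, hs3, hx3, hi3⟩ := loop (l n T a) [] s2 rfl h2r h2r1 hs2
  refine ⟨_, _, .seq (.assign _ _ _) (.seq hb1 (.seq (.assign _ _ _) (.seq hb2
    (.seq hb3 (.assign _ _ _))))), ?_, ?_, ?_⟩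
  · simp [Expr.eval, hs3]
  · intro x hx
    rw [Function.update_of_ne (by omega), hx3 x hx, hx2 x (by omega),
      Function.update_of_ne (by omega), hx1 x (by omega), Function.update_of_ne (by omega)]
  · have k1 := ho n T a _ List.prefix_rfl
    have k2 := Nat.mul_le_mul_right (step.eval (codeSize a))
      ((length_le_codeSize (l n T a)).trans (hpl n T a))
    simp only [codeSize] at *
    simp [Expr.cost, hs, hs3, h1r]
    omega

end PolyTime

/-! ### Operations on lists -/

namespace PolyTime

variable {α β γ δ : ℕ → Type} [∀ n, Code (α n)] [∀ n, Code (β n)] [∀ n, Code (γ n)]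
  [∀ n, Code (δ n)]

theorem of_eq {f g : ∀ n, Mvdf n → α n → β n} (hf : PolyTime f) (h : ∀ n T a, g n T a = f n T a) :
    PolyTime g :=
  hf.congr fun n T a => by rw [h]

/-- A fold whose accumulator grows in each step by an amount that does not depend on the
accumulator. -/
theorem foldl_of_growth {f : ∀ n, Mvdf n → α n × (β n × γ n) → γ n}
    {l : ∀ n, Mvdf n → α n → List (β n)} {b : ∀ n, Mvdf n → α n → γ n} (hf : PolyTime f)
    (hl : PolyTime l) (hb : PolyTime b) (q : ℕ[X])
    (hq : ∀ n T a x y, codeSize (f n T (a, x, y)) ≤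
      codeSize y + q.eval (codeSize a + codeSize x)) :
    PolyTime (fun n T a => (l n T a).foldl (fun y x => f n T (a, x, y)) (b n T a)) := by
  obtain ⟨pl, hpl, -⟩ := id hl
  obtain ⟨pb, hpb, -⟩ := id hb
  -- There are at most `pl` steps, and each adds at most `q` at the size of the argument plus that
  -- of the list.
  refine foldl hf hl hb (pb + pl * q.comp (X + pl)) fun n T a t ht => ?_
  have key : ∀ (t : List (β n)) (y : γ n), (∀ x ∈ t, codeSize x ≤ codeSize (l n T a)) →
      codeSize (t.foldl (fun y x => f n T (a, x, y)) y) ≤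
        codeSize y + t.length * q.eval (codeSize a + codeSize (l n T a)) := by
    intro t
    induction t with
    | nil => simp
    | cons x t ih =>
      intro y hx
      have h1 := ih (f n T (a, x, y)) (fun z hz => hx z (List.mem_cons_of_mem _ hz))
      have h2 := hq n T a x y
      have h3 := eval_le_eval q (Nat.add_le_add_left (hx x List.mem_cons_self) (codeSize a))
      simp only [List.foldl_cons, List.length_cons, Nat.succ_mul]
      omega
  have h1 := key t (b n T a) (fun x hx => codeSize_le_of_mem (ht.subset hx))
  have h2 := hpb n T a
  have h3 := Nat.mul_le_mul ((ht.length_le.trans (length_le_codeSize _)).trans (hpl n T a))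
    (eval_le_eval q (Nat.add_le_add_left (hpl n T a) (codeSize a)))
  simp only [eval_add, eval_mul, eval_comp, eval_X]
  omega

theorem cons {f : ∀ n, Mvdf n → α n → β n} {l : ∀ n, Mvdf n → α n → List (β n)}
    (hf : PolyTime f) (hl : PolyTime l) : PolyTime (fun n T a => f n T a :: l n T a) :=
  (hf.pair hl).congr fun _ _ _ => rfl

theorem reverse {l : ∀ n, Mvdf n → α n → List (β n)} (hl : PolyTime l) :
    PolyTime (fun n T a => (l n T a).reverse) := by
  refine (foldl_of_growth (f := fun n T (p : α n × (β n × List (β n))) => p.2.1 :: p.2.2)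
    (PolyTime.id.snd.fst.cons PolyTime.id.snd.snd) hl
    (const_nil (f := fun _ _ _ => []) fun _ _ _ => rfl)
    (X + 1) fun n T a x y => ?_).of_eq fun n T a => ?_
  · simp; omega
  · simp [List.foldl_flip_cons_eq_append]

theorem foldr_of_growth {f : ∀ n, Mvdf n → α n × (β n × γ n) → γ n}
    {l : ∀ n, Mvdf n → α n → List (β n)} {b : ∀ n, Mvdf n → α n → γ n} (hf : PolyTime f)
    (hl : PolyTime l) (hb : PolyTime b) (q : ℕ[X])
    (hq : ∀ n T a x y, codeSize (f n T (a, x, y)) ≤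
      codeSize y + q.eval (codeSize a + codeSize x)) :
    PolyTime (fun n T a => (l n T a).foldr (fun x y => f n T (a, x, y)) (b n T a)) :=
  (foldl_of_growth hf hl.reverse hb q hq).of_eq fun n T a => by rw [List.foldl_reverse]

theorem map {f : ∀ n, Mvdf n → α n × β n → γ n} {l : ∀ n, Mvdf n → α n → List (β n)}
    (hf : PolyTime f) (hl : PolyTime l) :
    PolyTime (fun n T a => (l n T a).map (fun x => f n T (a, x))) := by
  obtain ⟨q, hq, -⟩ := id hf
  refine (foldr_of_growth (f := fun n T (p : α n × (β n × List (γ n))) =>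
    f n T (p.1, p.2.1) :: p.2.2)
    ((hf.comp (PolyTime.id.fst.pair PolyTime.id.snd.fst)).cons PolyTime.id.snd.snd) hl
    (const_nil (f := fun _ _ _ => []) fun _ _ _ => rfl)
    (q.comp (X + 1) + 1) fun n T a x y => ?_).of_eq fun n T a => ?_
  · have := hq n T (a, x)
    simp at this ⊢
    omega
  · simp only [List.map_eq_foldr]

theorem append {l m : ∀ n, Mvdf n → α n → List (β n)} (hl : PolyTime l) (hm : PolyTime m) :
    PolyTime (fun n T a => l n T a ++ m n T a) := by
  refine (foldr_of_growth (f := fun n T (p : α n × (β n × List (β n))) => p.2.1 :: p.2.2)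
    (PolyTime.id.snd.fst.cons PolyTime.id.snd.snd) hl hm (X + 1) fun n T a x y => ?_).of_eq
    fun n T a => ?_
  · simp; omega
  · simp

theorem tail {l : ∀ n, Mvdf n → α n → List (β n)} (hl : PolyTime l) :
    PolyTime (fun n T a => (l n T a).tail) :=
  comp (g := fun n _ (a : List (β n)) => a.tail) (of_expr (fun r => .tail (.reg r)) (2 * X)
    fun n T a r s hs => by
      rcases a with _ | ⟨x, a⟩ <;>
        simp [Expr.eval, Expr.cost, hs, codeSize, Data.tail, Data.size]; omega) hl

/-- The default is forced: the head of the empty tree is `nil`, which is the code of `false`. -/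
theorem headD_false {l : ∀ n, Mvdf n → α n → List Bool} (hl : PolyTime l) :
    PolyTime (fun n T a => (l n T a).headD false) :=
  comp (g := fun _ _ (a : List Bool) => a.headD false) (of_expr (fun r => .head (.reg r)) (2 * X)
    fun n T a r s hs => by
      rcases a with _ | ⟨x, a⟩ <;>
        simp [Expr.eval, Expr.cost, hs, codeSize, Data.head, Data.size]; omega) hl

end PolyTime

/-! ## Sets of variables -/

/-- The characteristic vector of a set. -/
def bits {n : ℕ} (s : Finset (Fin n)) : List Bool := (List.finRange n).map (fun v => decide (v ∈ s))

theorem code_bits {n : ℕ} (s : Finset (Fin n)) : code (bits s) = code s := by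
  simp only [code, codeSet, bits, List.map_map]
  rfl

theorem codeSize_bits {n : ℕ} (s : Finset (Fin n)) : codeSize (bits s) = codeSize s := by
  rw [codeSize, code_bits, codeSize]

@[simp] theorem length_bits {n : ℕ} (s : Finset (Fin n)) : (bits s).length = n := by
  simp [bits]

theorem codeSize_list_bool_le (l : List Bool) : codeSize l ≤ 4 * l.length + 1 := by
  induction l with
  | nil => simp
  | cons b l ih =>
    have := codeSize_bool_le b
    simp only [codeSize_cons, List.length_cons]
    omega

theorem codeSize_set_le {n : ℕ} (s : Finset (Fin n)) : codeSize s ≤ 4 * n + 1 := by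
  rw [← codeSize_bits]
  exact (codeSize_list_bool_le _).trans (by simp)

theorem le_codeSize_set {n : ℕ} (s : Finset (Fin n)) : n ≤ codeSize s := by
  rw [← codeSize_bits]
  exact (by simp : n ≤ (bits s).length).trans (length_le_codeSize _)

theorem codeSize_fin_le {n : ℕ} (v : Fin n) : codeSize v ≤ 4 * n + 1 :=
  codeSize_set_le {v}

theorem le_codeSize_fin {n : ℕ} (v : Fin n) : n ≤ codeSize v :=
  le_codeSize_set {v}

theorem codeSize_list_le {α : Type} [Code α] (l : List α) (B : ℕ) (h : ∀ x ∈ l, codeSize x ≤ B) :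
    codeSize l ≤ l.length * (B + 1) + 1 := by
  induction l with
  | nil => simp
  | cons x l ih =>
    have h1 := h x List.mem_cons_self
    have h2 := ih fun y hy => h y (List.mem_cons_of_mem _ hy)
    simp only [codeSize_cons, List.length_cons, Nat.succ_mul]
    omega

/-- One step of the computation of the list of all variables. -/
def varsStep (p : List Bool × List (List Bool)) : List Bool × List (List Bool) :=
  (false :: p.1, (true :: p.1) :: p.2.map (fun l => false :: l))

theorem bits_empty (n : ℕ) : bits (∅ : Finset (Fin n)) = List.replicate n false := by
  simp [bits]

theorem iterate_varsStep (k : ℕ) : varsStep^[k] ([], []) =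
    (bits (∅ : Finset (Fin k)), (List.finRange k).map (fun v => bits {v})) := by
  induction k with
  | zero => rfl
  | succ k ih =>
    rw [Function.iterate_succ_apply', ih, varsStep, bits_empty, bits_empty]
    simp only [List.replicate_succ, List.finRange_succ, List.map_cons, List.map_map, Prod.mk.injEq,
      List.cons.injEq, true_and]
    constructor
    · rw [bits, List.finRange_succ, ← bits_empty, bits]
      simp [Function.comp_def, Fin.succ_ne_zero]
    · refine List.map_congr_left fun v _ => ?_
      simp only [Function.comp, bits, List.finRange_succ, List.map_cons, List.map_map]
      simp [Fin.succ_ne_zero, eq_comm]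

theorem codeSize_iterate_varsStep_le (k : ℕ) :
    codeSize (varsStep^[k] ([], [])) ≤ 4 * k + 1 + (k * (4 * k + 2) + 1) + 1 := by
  rw [iterate_varsStep, codeSize_pair, codeSize_bits]
  have h1 := codeSize_set_le (∅ : Finset (Fin k))
  have h2 := codeSize_list_le ((List.finRange k).map (fun v => bits {v})) (4 * k + 1) (by
    simp only [List.mem_map, forall_exists_index, and_imp]
    rintro _ v - rfl
    rw [codeSize_bits]
    exact codeSize_set_le _)
  simp only [List.length_map, List.length_finRange, add_assoc, Nat.reduceAdd] at h1 h2 ⊢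
  omega

theorem foldl_const {α β : Type} (f : β → β) (b : β) (l : List α) :
    l.foldl (fun y _ => f y) b = f^[l.length] b := by
  induction l generalizing b with
  | nil => rfl
  | cons x l ih => simp [ih]

namespace PolyTime

variable {α β γ δ : ℕ → Type} [∀ n, Code (α n)] [∀ n, Code (β n)] [∀ n, Code (γ n)]
  [∀ n, Code (δ n)]

theorem bits {s : ∀ n, Mvdf n → α n → Finset (Fin n)} (hs : PolyTime s) :
    PolyTime (fun n T a => bits (s n T a)) :=
  hs.congr fun _ _ _ => code_bits _

theorem singleton {v : ∀ n, Mvdf n → α n → Fin n} (hv : PolyTime v) :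
    PolyTime (fun n T a => ({v n T a} : Finset (Fin n))) :=
  hv.congr fun _ _ _ => rfl

/-- A program learns `n` from the length of a characteristic vector; `s` only supplies such a
vector. -/
theorem finRange {s : ∀ n, Mvdf n → α n → Finset (Fin n)} (hs : PolyTime s) :
    PolyTime (fun n _ (_ : α n) => List.finRange n) := by
  have hstep : PolyTime (fun n T (p : α n × (Bool × (List Bool × List (List Bool)))) =>
      varsStep p.2.2) := by
    refine (PolyTime.cons (const_bool false) PolyTime.id.snd.snd.fst).pair
      ((PolyTime.cons (const_bool true) PolyTime.id.snd.snd.fst).cons (map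
        (f := fun n T (p : (α n × (Bool × (List Bool × List (List Bool)))) × List Bool) =>
          false :: p.2) (PolyTime.cons (const_bool false) PolyTime.id.snd) PolyTime.id.snd.snd.snd))
  have hb : PolyTime (fun n T (a : α n) => (([], []) : List Bool × List (List Bool))) :=
    (const_nil fun _ _ _ => rfl).pair (const_nil fun _ _ _ => rfl)
  obtain ⟨p, hp, -⟩ := id hs
  have := (foldl hstep hs.bits hb (4 * p + 1 + (p * (4 * p + 2) + 1) + 1)
    fun n T a t ht => ?_).snd
  · refine this.congr fun n T a => ?_
    rw [foldl_const, length_bits, iterate_varsStep]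
    simp only [code, List.map_map]
    congr 1
    refine List.map_congr_left fun v _ => ?_
    exact (code_bits {v}).symm
  · rw [foldl_const]
    refine (codeSize_iterate_varsStep_le _).trans ?_
    have h1 : t.length ≤ p.eval (codeSize a) := by
      have := ht.length_le
      rw [length_bits] at this
      exact this.trans ((le_codeSize_set _).trans (hp n T a))
    simp only [eval_add, eval_mul, eval_one, eval_ofNat]
    gcongr

/-- The vectors of `{v}` and of `s` are traversed in parallel, and the bit of `s` at the only true
position of `{v}` is kept. -/
theorem mem {v : ∀ n, Mvdf n → α n → Fin n} {s : ∀ n, Mvdf n → α n → Finset (Fin n)}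
    (hv : PolyTime v) (hs : PolyTime s) : PolyTime (fun n T a => decide (v n T a ∈ s n T a)) := by
  have hstep : PolyTime (fun n T (p : α n × (Bool × (List Bool × Bool))) =>
      (p.2.2.1.tail, if p.2.1 = true then p.2.2.1.headD false else p.2.2.2)) :=
    PolyTime.id.snd.snd.fst.tail.pair
      (.ite PolyTime.id.snd.fst PolyTime.id.snd.snd.fst.headD_false PolyTime.id.snd.snd.snd)
  have key : ∀ {k : Type} [DecidableEq k] (v : k) (q : k → Bool) (l : List k) (b : Bool), l.Nodup →
      ((l.map (fun w => decide (w = v))).foldl (fun y x => (y.1.tail,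
        if x = true then y.1.headD false else y.2)) (l.map q, b)) =
        (([] : List Bool), if v ∈ l then q v else b) := by
    intro k _ v q l
    induction l with
    | nil => simp
    | cons w l ih =>
      intro b hl
      rw [List.nodup_cons] at hl
      simp only [List.map_cons, List.foldl_cons, List.tail_cons, ih _ hl.2]
      by_cases h : w = v
      · subst h; simp [hl.1]
      · simp [h, Ne.symm h]
  refine (foldl_of_growth hstep hv.singleton.bits (hs.bits.pair (const_bool false)) 3
    fun n T a x y => ?_).snd.of_eq fun n T a => ?_
  · obtain ⟨l, b⟩ := y
    have h1 : codeSize l.tail ≤ codeSize l := by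
      cases l <;> simp; omega
    have h2 := codeSize_bool_le (if x = true then l.headD false else b)
    simp only [codeSize_pair, eval_ofNat]
    omega
  · have := key (v n T a) (fun w => decide (w ∈ s n T a)) (List.finRange n) false
      (List.nodup_finRange n)
    simp only [ExactLearning.bits, Finset.mem_singleton] at this ⊢
    rw [this]
    simp

variable {P Q : ∀ n, Mvdf n → α n → Prop}

open Classical in
/-- Properties that are decided in polynomial time. -/
def _root_.ExactLearning.PolyTimePred (P : ∀ n, Mvdf n → α n → Prop) : Prop :=
  PolyTime (fun n T a => decide (P n T a))

/-- Set comprehension. -/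
theorem filter {s : ∀ n, Mvdf n → α n → Finset (Fin n)} {q : ∀ n, Mvdf n → α n × Fin n → Prop}
    [∀ n T p, Decidable (q n T p)] (hs : PolyTime s) (hq : PolyTimePred q) :
    PolyTime (fun n T a => Finset.univ.filter (fun v => q n T (a, v))) := by
  refine (map hq hs.finRange).congr fun n T a => ?_
  simp only [code, codeSet, List.map_map]
  congr 1
  refine List.map_congr_left fun v _ => ?_
  simp only [Function.comp]
  congr 1
  simp

theorem ite_prop [∀ n T a, Decidable (P n T a)] {f g : ∀ n, Mvdf n → α n → β n}
    (hP : PolyTimePred P) (hf : PolyTime f) (hg : PolyTime g) :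
    PolyTime (fun n T a => if P n T a then f n T a else g n T a) :=
  (ite hP hf hg).of_eq fun n T a => by
    by_cases h : P n T a <;> simp [h]

end PolyTime

/-! ### Polynomial-time predicates -/

namespace PolyTimePred

variable {α β : ℕ → Type} [∀ n, Code (α n)] [∀ n, Code (β n)] {P Q : ∀ n, Mvdf n → α n → Prop}

theorem of_eq (hP : PolyTimePred P) (h : ∀ n T a, Q n T a ↔ P n T a) : PolyTimePred Q :=
  PolyTime.of_eq hP fun n T a => by simp [h]

theorem not (hP : PolyTimePred P) : PolyTimePred (fun n T a => ¬ P n T a) :=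
  (PolyTime.ite hP (.const_bool false) (.const_bool true)).of_eq fun n T a => by
    by_cases h : P n T a <;> simp [h]

theorem and (hP : PolyTimePred P) (hQ : PolyTimePred Q) :
    PolyTimePred (fun n T a => P n T a ∧ Q n T a) :=
  (PolyTime.ite hP hQ (.const_bool false)).of_eq fun n T a => by
    by_cases h : P n T a <;> simp [h]

theorem or (hP : PolyTimePred P) (hQ : PolyTimePred Q) :
    PolyTimePred (fun n T a => P n T a ∨ Q n T a) :=
  (PolyTime.ite hP (.const_bool true) hQ).of_eq fun n T a => by
    by_cases h : P n T a <;> simp [h]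

theorem mem {v : ∀ n, Mvdf n → α n → Fin n} {s : ∀ n, Mvdf n → α n → Finset (Fin n)}
    (hv : PolyTime v) (hs : PolyTime s) : PolyTimePred (fun n T a => v n T a ∈ s n T a) :=
  (PolyTime.mem hv hs).of_eq fun n T a => by congr

theorem eq {f g : ∀ n, Mvdf n → α n → β n} (hf : PolyTime f)
    (hg : PolyTime g) (hinj : ∀ n, Function.Injective (code : β n → Data)) :
    PolyTimePred (fun n T a => f n T a = g n T a) := by
  classical exact (PolyTime.beq hf hg hinj).of_eq fun n T a => by congr

theorem entails {e : ∀ n, Mvdf n → α n → QuasiHornClause 2 n} (he : PolyTime e) :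
    PolyTimePred (fun n T a => T.Entails (e n T a)) :=
  PolyTime.member.comp he

theorem isTrue {b : ∀ n, Mvdf n → α n → Bool} (hb : PolyTime b) :
    PolyTimePred (fun n T a => b n T a = true) :=
  hb.of_eq fun n T a => by simp

end PolyTimePred

namespace PolyTime

variable {α : ℕ → Type} [∀ n, Code (α n)] {A B : ∀ n, Mvdf n → α n → Finset (Fin n)}

theorem inter (hA : PolyTime A) (hB : PolyTime B) : PolyTime (fun n T a => A n T a ∩ B n T a) :=
  (filter hA (q := fun n T (p : α n × Fin n) => p.2 ∈ A n T p.1 ∧ p.2 ∈ B n T p.1)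
    (.and (.mem PolyTime.id.snd (hA.comp PolyTime.id.fst))
      (.mem PolyTime.id.snd (hB.comp PolyTime.id.fst)))).of_eq fun n T a => by ext; simp

theorem union (hA : PolyTime A) (hB : PolyTime B) : PolyTime (fun n T a => A n T a ∪ B n T a) :=
  (filter hA (q := fun n T (p : α n × Fin n) => p.2 ∈ A n T p.1 ∨ p.2 ∈ B n T p.1)
    (.or (.mem PolyTime.id.snd (hA.comp PolyTime.id.fst))
      (.mem PolyTime.id.snd (hB.comp PolyTime.id.fst)))).of_eq fun n T a => by ext; simp

theorem compl (hA : PolyTime A) : PolyTime (fun n T a => (A n T a)ᶜ) :=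
  (filter hA (q := fun n T (p : α n × Fin n) => ¬ p.2 ∈ A n T p.1)
    (.not (.mem PolyTime.id.snd (hA.comp PolyTime.id.fst)))).of_eq fun n T a => by ext; simp

theorem sdiff (hA : PolyTime A) (hB : PolyTime B) : PolyTime (fun n T a => A n T a \ B n T a) :=
  (inter hA hB.compl).of_eq fun n T a => by ext; simp

theorem _root_.ExactLearning.PolyTimePred.subset (hA : PolyTime A) (hB : PolyTime B) :
    PolyTimePred (fun n T a => A n T a ⊆ B n T a) :=
  (PolyTimePred.eq (inter hA hB) hA fun _ => codeSet_injective).of_eq fun n T a => by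
    simp only [Finset.inter_eq_left]

end PolyTime

/-! ## Models of multivalued dependency formulas -/

section Semantics

variable {n : ℕ}

/-- The interpretation in which exactly the variables of `F` are false. -/
def ofFalse (F : Finset (Fin n)) : Interpretation n := fun v => decide (v ∉ F)

@[simp] theorem falseSet_ofFalse (F : Finset (Fin n)) : (ofFalse F).falseSet = F := by
  ext v; simp [Interpretation.falseSet, ofFalse]

@[simp] theorem trueSet_ofFalse (F : Finset (Fin n)) : (ofFalse F).trueSet = Fᶜ := by
  ext v; simp [Interpretation.trueSet, ofFalse]

theorem ofFalse_falseSet (I : Interpretation n) : ofFalse I.falseSet = I := by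
  ext v; simp [Interpretation.falseSet, ofFalse]

/-- `T` is true when exactly the variables of `F` are false. -/
def Sat (T : Mvdf n) (F : Finset (Fin n)) : Prop := (ofFalse F).Models T

/-- `F` lies in the right-hand side of the clause and meets both of its parts. -/
def Crosses (c : MvdClause n) (F : Finset (Fin n)) : Prop :=
  F ⊆ c.Y ∪ c.Z ∧ (∃ v ∈ F, v ∈ c.Y) ∧ ∃ w ∈ F, w ∈ c.Z

theorem MvdClause.compl_X (c : MvdClause n) : c.Xᶜ = c.Y ∪ c.Z := by
  ext v
  have h1 : v ∈ c.X ∪ c.Y ∪ c.Z := c.cover ▸ Finset.mem_univ v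
  have h2 : v ∈ c.X → v ∉ c.Y := fun h => Finset.disjoint_left.mp c.disjoint_XY h
  have h3 : v ∈ c.X → v ∉ c.Z := fun h => Finset.disjoint_left.mp c.disjoint_XZ h
  simp only [Finset.mem_union, Finset.mem_compl] at h1 ⊢
  tauto

theorem violates_ofFalse_iff {F : Finset (Fin n)} {c : MvdClause n} :
    (ofFalse F).Violates c ↔ Crosses c F ∨
      ((c.Y = ∅ ∨ c.Z = ∅) ∧ ∃ v ∈ c.Y ∪ c.Z, F = {v}) ∨ (F = ∅ ∧ c.Y ∪ c.Z = ∅) := by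
  rw [Interpretation.Violates, falseSet_ofFalse, trueSet_ofFalse, Finset.subset_compl_comm,
    c.compl_X]
  constructor
  · rintro ⟨h, ⟨-, -, v, hv, w, hw, hvF, hwF⟩ | h2 | ⟨hF, -, hY, hZ⟩⟩
    · exact .inl ⟨h, ⟨v, hvF, hv⟩, w, hwF, hw⟩
    · exact .inr (.inl h2)
    · exact .inr (.inr ⟨hF, by simp [hY, hZ]⟩)
  · rintro (⟨h, ⟨v, hvF, hv⟩, w, hwF, hw⟩ | ⟨h, v, hv, rfl⟩ | ⟨hF, h⟩)
    · exact ⟨h, .inl ⟨⟨v, hv⟩, ⟨w, hw⟩, v, hv, w, hw, hvF, hwF⟩⟩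
    · exact ⟨by simpa using hv, .inr (.inl ⟨h, v, hv, rfl⟩)⟩
    · refine ⟨by simp [hF], .inr (.inr ⟨hF, ?_, ?_, ?_⟩)⟩
      · rw [← compl_compl c.X, c.compl_X, h, Finset.compl_empty]
      · exact (Finset.union_eq_empty.mp h).1
      · exact (Finset.union_eq_empty.mp h).2

theorem entails_iff {k : ℕ} {T : Mvdf n} {e : QuasiHornClause k n} :
    T.Entails e ↔ ∀ F, Sat T F → Disjoint e.neg F → ¬ e.pos ⊆ F := by
  have key : ∀ F : Finset (Fin n), (ofFalse F).Satisfies e ↔ (Disjoint e.neg F → ¬ e.pos ⊆ F) := by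
    intro F
    simp only [Interpretation.Satisfies, ofFalse, Finset.disjoint_left, Finset.not_subset,
      decide_eq_false_iff_not, not_not, decide_eq_true_eq]
    constructor
    · rintro (⟨v, h1, h2⟩ | h) h3
      · exact absurd h2 (h3 h1)
      · exact h
    · intro h
      by_cases h3 : ∃ v ∈ e.neg, v ∈ F
      · exact .inl h3
      · exact .inr (h fun v hv hF => h3 ⟨v, hv, hF⟩)
  refine ⟨fun h F hF => (key F).mp (h _ hF), fun h I hI => ?_⟩
  rw [← ofFalse_falseSet I] at hI ⊢
  exact (key _).mpr (h _ hI)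

theorem not_sat_iff {T : Mvdf n} {F : Finset (Fin n)} :
    ¬ Sat T F ↔ ∃ c ∈ T, (ofFalse F).Violates c := by
  simp [Sat, Interpretation.Models]

theorem not_sat_of_crosses {T : Mvdf n} {F : Finset (Fin n)} {c : MvdClause n} (hc : c ∈ T)
    (h : Crosses c F) : ¬ Sat T F :=
  not_sat_iff.mpr ⟨c, hc, violates_ofFalse_iff.mpr (.inl h)⟩

theorem sat_mono {S T : Mvdf n} {F : Finset (Fin n)} (h : S ⊆ T) (hT : Sat T F) : Sat S F :=
  fun c hc => hT c (h hc)

/-- The shared variable `y` lies in one part of the clause. Whichever of `F` and `G` contains the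
witness for the other part is crossed, by `y` and this witness. -/
theorem crosses_or_crosses_of_union {c : MvdClause n} {F G : Finset (Fin n)} {y : Fin n}
    (hF : y ∈ F) (hG : y ∈ G) (h : Crosses c (F ∪ G)) : Crosses c F ∨ Crosses c G := by
  obtain ⟨hs, ⟨v, hv, hvY⟩, w, hw, hwZ⟩ := h
  have hFs := Finset.union_subset_left hs
  have hGs := Finset.union_subset_right hs
  rcases Finset.mem_union.mp (hFs hF) with hy | hy
  · rcases Finset.mem_union.mp hw with hw | hw
    · exact .inl ⟨hFs, ⟨y, hF, hy⟩, w, hw, hwZ⟩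
    · exact .inr ⟨hGs, ⟨y, hG, hy⟩, w, hw, hwZ⟩
  · rcases Finset.mem_union.mp hv with hv | hv
    · exact .inl ⟨hFs, ⟨v, hv, hvY⟩, y, hF, hy⟩
    · exact .inr ⟨hGs, ⟨v, hv, hvY⟩, y, hG, hy⟩

/-- Models whose sets of false variables meet are closed under intersection. -/
theorem Sat.union {T : Mvdf n} {F G : Finset (Fin n)} {y : Fin n} (hF : Sat T F) (hG : Sat T G)
    (hyF : y ∈ F) (hyG : y ∈ G) : Sat T (F ∪ G) := by
  by_contra h
  obtain ⟨c, hc, hv⟩ := not_sat_iff.mp h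
  rcases violates_ofFalse_iff.mp hv with h | ⟨h, v, hv, h1⟩ | ⟨h, -⟩
  · rcases crosses_or_crosses_of_union hyF hyG h with h | h
    · exact not_sat_of_crosses hc h hF
    · exact not_sat_of_crosses hc h hG
  · have hFv : F = {v} := by
      refine (Finset.subset_singleton_iff.mp (h1 ▸ Finset.subset_union_left)).resolve_left ?_
      rintro rfl
      simp at hyF
    exact hF c hc (violates_ofFalse_iff.mpr (.inr (.inl ⟨h, v, hv, hFv⟩)))
  · simp [(Finset.union_eq_empty.mp h).1] at hyF

/-! ## Blocks -/

/-- The clause `V \ G → y ∨ z`. -/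
def pairClause (G : Finset (Fin n)) (y z : Fin n) : QuasiHornClause 2 n :=
  ⟨Gᶜ, {y, z}, Finset.card_le_two⟩

theorem not_entails_pairClause {T : Mvdf n} {G : Finset (Fin n)} {y z : Fin n} :
    ¬ T.Entails (pairClause G y z) ↔ ∃ F, Sat T F ∧ F ⊆ G ∧ y ∈ F ∧ z ∈ F := by
  rw [entails_iff]
  simp only [pairClause, not_forall, not_not, Finset.insert_subset_iff,
    Finset.singleton_subset_iff, disjoint_compl_left_iff]
  constructor
  · rintro ⟨F, h1, h2, h3⟩; exact ⟨F, h1, h2, h3⟩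
  · rintro ⟨F, h1, h2, h3⟩; exact ⟨F, h1, h2, h3⟩

open Classical in
/-- The variable `y` with all variables that can be false together with `y` while only variables of
`G` are false. -/
noncomputable def block (T : Mvdf n) (y : Fin n) (G : Finset (Fin n)) : Finset (Fin n) :=
  Finset.univ.filter (fun z => z = y ∨ z ∈ G ∧ ¬ T.Entails (pairClause G y z))

variable {T : Mvdf n} {y : Fin n} {F G : Finset (Fin n)}

theorem mem_block {z : Fin n} : z ∈ block T y G ↔
    z = y ∨ z ∈ G ∧ ∃ F, Sat T F ∧ F ⊆ G ∧ y ∈ F ∧ z ∈ F := by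
  simp [block, not_entails_pairClause]

theorem self_mem_block : y ∈ block T y G := mem_block.mpr (.inl rfl)

theorem block_subset (hy : y ∈ G) : block T y G ⊆ G := fun z hz => by
  rcases mem_block.mp hz with rfl | h
  exacts [hy, h.1]

theorem Sat.block_eq (hG : Sat T G) (hy : y ∈ G) : block T y G = G :=
  (block_subset hy).antisymm fun _ hz => mem_block.mpr (.inr ⟨hz, G, hG, subset_rfl, hy, hz⟩)

/-- A model containing `y` and `p` can be united with `F`. So no model inside `G` has elements both
in the block and outside it. -/
theorem Sat.subset_block (hF : Sat T F) (hFG : F ⊆ G) {p : Fin n} (hp : p ∈ block T y G)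
    (hpF : p ∈ F) : F ⊆ block T y G := by
  intro z hz
  rcases mem_block.mp hp with rfl | ⟨-, E, hE, hEG, hyE, hpE⟩
  · exact mem_block.mpr (.inr ⟨hFG hz, F, hF, hFG, hpF, hz⟩)
  · exact mem_block.mpr (.inr ⟨hFG hz, E ∪ F, hE.union hF hpE hpF, Finset.union_subset hEG hFG,
      Finset.mem_union_left _ hyE, Finset.mem_union_right _ hz⟩)

/-- `G` is the union of the models that put its elements together with `y`. A second element is
needed to have a model at all: the block of `y` in `{y}` is `{y}` even if `{y}` is not a model. -/
theorem sat_of_block_eq (hG : 1 < G.card) (h : block T y G = G) : Sat T G := by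
  have key : ∀ z ∈ G, z ≠ y → ∃ F, Sat T F ∧ F ⊆ G ∧ y ∈ F ∧ z ∈ F := fun z hz hzy => by
    rw [← h] at hz
    exact ((mem_block.mp hz).resolve_left hzy).2
  have all : ∀ S ⊆ G, ∃ F, Sat T F ∧ F ⊆ G ∧ y ∈ F ∧ S ⊆ F := by
    intro S
    induction S using Finset.induction_on with
    | empty =>
      intro _
      obtain ⟨z, hz, hzy⟩ := Finset.exists_mem_ne hG y
      obtain ⟨F, h1, h2, h3, -⟩ := key z hz hzy
      exact ⟨F, h1, h2, h3, Finset.empty_subset _⟩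
    | insert z S _ ih =>
      intro hS
      obtain ⟨hz, hS⟩ := Finset.insert_subset_iff.mp hS
      obtain ⟨F, h1, h2, h3, h4⟩ := ih hS
      by_cases hzy : z = y
      · exact ⟨F, h1, h2, h3, Finset.insert_subset (hzy ▸ h3) h4⟩
      · obtain ⟨E, k1, k2, k3, k4⟩ := key z hz hzy
        exact ⟨E ∪ F, k1.union h1 k3 h3, Finset.union_subset k2 h2, Finset.mem_union_left _ k3,
          Finset.insert_subset (Finset.mem_union_left _ k4)
            (h4.trans Finset.subset_union_right)⟩
  obtain ⟨F, h1, h2, -, h4⟩ := all G subset_rfl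
  exact h2.antisymm h4 ▸ h1

/-- Models through `y` inside `G` cannot cross `c`, hence stay on the side of `y`. -/
theorem block_subset_or_subset {c : MvdClause n} (hc : c ∈ T) (hy : y ∈ G) (hG : G ⊆ c.Y ∪ c.Z) :
    block T y G ⊆ c.Y ∨ block T y G ⊆ c.Z := by
  rcases Finset.mem_union.mp (hG hy) with hyc | hyc
  · left
    intro z hz
    rcases mem_block.mp hz with rfl | ⟨hzG, F, hF, hFG, hyF, hzF⟩
    · exact hyc
    · refine (Finset.mem_union.mp (hG hzG)).resolve_right fun hzc => ?_
      exact not_sat_of_crosses hc ⟨hFG.trans hG, ⟨y, hyF, hyc⟩, z, hzF, hzc⟩ hF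
  · right
    intro z hz
    rcases mem_block.mp hz with rfl | ⟨hzG, F, hF, hFG, hyF, hzF⟩
    · exact hyc
    · refine (Finset.mem_union.mp (hG hzG)).resolve_left fun hzc => ?_
      exact not_sat_of_crosses hc ⟨hFG.trans hG, ⟨z, hzF, hzc⟩, y, hyF, hyc⟩ hF

theorem Crosses.not_subset_block {c : MvdClause n} (h : Crosses c F) (hc : c ∈ T) (hy : y ∈ G)
    (hG : G ⊆ c.Y ∪ c.Z) : ¬ F ⊆ block T y G := by
  intro hF
  obtain ⟨-, ⟨v, hv, hvY⟩, w, hw, hwZ⟩ := h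
  rcases block_subset_or_subset hc hy hG with h | h
  · exact Finset.disjoint_left.mp c.disjoint_YZ (h (hF hw)) hwZ
  · exact Finset.disjoint_left.mp c.disjoint_YZ hvY (h (hF hv))

theorem Crosses.block_ne {c : MvdClause n} (h : Crosses c G) (hc : c ∈ T) (hy : y ∈ G) :
    block T y G ≠ G :=
  fun he => h.not_subset_block hc hy h.1 he.ge

/-- `G` is no model, and the other two kinds of violation are impossible: a singleton is its own
block, and the empty set does not contain `y`. This ties each record to a clause of the target. -/
theorem exists_crosses (hy : y ∈ G) (h : block T y G ≠ G) : ∃ c ∈ T, Crosses c G := by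
  obtain ⟨c, hc, hv⟩ := not_sat_iff.mp fun hG => h (hG.block_eq hy)
  refine ⟨c, hc, ?_⟩
  rcases violates_ofFalse_iff.mp hv with h1 | ⟨-, v, -, rfl⟩ | ⟨rfl, -⟩
  · exact h1
  · obtain rfl := Finset.mem_singleton.mp hy
    exact absurd ((block_subset hy).antisymm (Finset.singleton_subset_iff.mpr self_mem_block)) h
  · simp at hy

/-! ## Hypotheses -/

/-- The clause `V \ G → P ∨ (G \ P)`. -/
def splitClause (P G : Finset (Fin n)) : MvdClause n where
  X := Gᶜ
  Y := P ∩ G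
  Z := G \ P
  disjoint_XY := disjoint_compl_left.mono_right Finset.inter_subset_right
  disjoint_XZ := disjoint_compl_left.mono_right Finset.sdiff_subset
  disjoint_YZ := Finset.disjoint_sdiff.mono_left Finset.inter_subset_left
  cover := by ext v; simp; tauto

theorem splitClause_union (P G : Finset (Fin n)) :
    (splitClause P G).Y ∪ (splitClause P G).Z = G := by
  ext v; simp [splitClause]; tauto

/-- The clause `V → F`. -/
def bottomClause (n : ℕ) : QuasiHornClause 2 n := ⟨Finset.univ, ∅, by simp⟩

open Classical in
/-- The clauses of the hypotheses that concern the interpretations with at most one false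
variable. -/
noncomputable def baseClauses (T : Mvdf n) : Mvdf n :=
  (List.finRange n).foldr (fun v H =>
      if T.Entails (pairClause {v} v v) then splitClause {v} {v} :: H else H)
    (if T.Entails (bottomClause n) then [splitClause ∅ ∅] else [])

/-- A record `(y, G)` stands for the mvd clause that separates the block of `y` in `G` from the rest
of `G`. -/
abbrev Record (n : ℕ) := Fin n × Finset (Fin n)

/-- The hypothesis that belongs to a list of records. -/
noncomputable def hypothesis (T : Mvdf n) (L : List (Record n)) : Mvdf n :=
  L.map (fun e => splitClause (block T e.1 e.2) e.2) ++ baseClauses T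

theorem mem_baseClauses {c : MvdClause n} : c ∈ baseClauses T ↔
    (∃ v, T.Entails (pairClause {v} v v) ∧ c = splitClause {v} {v}) ∨
      (T.Entails (bottomClause n) ∧ c = splitClause ∅ ∅) := by
  have key : ∀ (l : List (Fin n)) (B : Mvdf n) (p : Fin n → Prop) [DecidablePred p]
      (f : Fin n → MvdClause n), c ∈ l.foldr (fun v H => if p v then f v :: H else H) B ↔
        (∃ v ∈ l, p v ∧ c = f v) ∨ c ∈ B := by
    intro l B p _ f
    induction l with
    | nil => simp
    | cons w l ih =>
      rw [List.foldr_cons]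
      split_ifs with h <;> simp [ih, h, or_assoc]
  rw [baseClauses, key]
  split_ifs with h <;> simp [h]

theorem entails_pairClause_singleton {v : Fin n} :
    T.Entails (pairClause {v} v v) ↔ ¬ Sat T {v} := by
  rw [← not_iff_not, not_entails_pairClause, not_not]
  constructor
  · rintro ⟨F, h1, h2, h3, -⟩
    rwa [h2.antisymm (Finset.singleton_subset_iff.mpr h3)] at h1
  · exact fun h => ⟨_, h, subset_rfl, by simp, by simp⟩

theorem entails_bottomClause : T.Entails (bottomClause n) ↔ ¬ Sat T ∅ := by
  rw [entails_iff]
  constructor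
  · intro h hs
    exact h ∅ hs (by simp) (by simp [bottomClause])
  · intro h F hF hd
    have : F = ∅ := top_disjoint.mp hd
    exact absurd (this ▸ hF) h

/-- Ensures that a model of the hypothesis that is not one of `T` has at least two false variables,
as `sat_of_block_eq` requires. -/
theorem sat_baseClauses_iff_of_card_le_one (hF : F.card ≤ 1) :
    Sat (baseClauses T) F ↔ Sat T F := by
  constructor
  · intro h
    by_contra hT
    rcases Nat.le_one_iff_eq_zero_or_eq_one.mp hF with h0 | h1
    · obtain rfl := Finset.card_eq_zero.mp h0
      refine h _ (mem_baseClauses.mpr (.inr ⟨entails_bottomClause.mpr hT, rfl⟩))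
        (violates_ofFalse_iff.mpr (.inr (.inr ⟨rfl, splitClause_union _ _⟩)))
    · obtain ⟨v, rfl⟩ := Finset.card_eq_one.mp h1
      refine h _ (mem_baseClauses.mpr (.inl ⟨v, entails_pairClause_singleton.mpr hT, rfl⟩))
        (violates_ofFalse_iff.mpr (.inr (.inl ⟨.inr (by simp [splitClause]), v, ?_, rfl⟩)))
      simp [splitClause_union]
  · intro h c hc hv
    rcases mem_baseClauses.mp hc with ⟨v, hT, rfl⟩ | ⟨hT, rfl⟩
    · rw [entails_pairClause_singleton] at hT
      rw [violates_ofFalse_iff, splitClause_union] at hv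
      rcases hv with ⟨-, -, w, -, hw⟩ | ⟨-, w, hw, rfl⟩ | ⟨-, h2⟩
      · simp [splitClause] at hw
      · exact hT (Finset.mem_singleton.mp hw ▸ h)
      · simp at h2
    · rw [entails_bottomClause] at hT
      rw [violates_ofFalse_iff, splitClause_union] at hv
      rcases hv with ⟨-, -, w, -, hw⟩ | ⟨-, w, hw, rfl⟩ | ⟨rfl, h2⟩
      · simp [splitClause] at hw
      · simp at hw
      · exact hT h

/-- These clauses have empty `Z`, so nothing with two or more false variables violates them. -/
theorem Sat.baseClauses (h : Sat T F) : Sat (baseClauses T) F := by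
  by_cases hF : F.card ≤ 1
  · exact (sat_baseClauses_iff_of_card_le_one hF).mpr h
  · intro c hc hv
    have : c.Z = ∅ := by
      rcases mem_baseClauses.mp hc with ⟨v, -, rfl⟩ | ⟨-, rfl⟩ <;> simp [splitClause]
    rcases violates_ofFalse_iff.mp hv with ⟨-, -, w, -, hw⟩ | ⟨-, w, hw, rfl⟩ | ⟨rfl, h2⟩
    · simp [this] at hw
    · simp at hF
    · simp at hF

/-- `L` consists of records whose clauses are not trivial. -/
def Proper (T : Mvdf n) (L : List (Record n)) : Prop :=
  ∀ e ∈ L, e.1 ∈ e.2 ∧ block T e.1 e.2 ≠ e.2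

/-- The hypotheses are consequences of the target. -/
theorem Sat.hypothesis {L : List (Record n)} (hL : Proper T L) (h : Sat T F) :
    Sat (hypothesis T L) F := by
  intro c hc
  rcases List.mem_append.mp hc with hc | hc
  · obtain ⟨⟨y, G⟩, he, rfl⟩ := List.mem_map.mp hc
    obtain ⟨hy, hG⟩ := hL _ he
    rw [violates_ofFalse_iff, splitClause_union]
    rintro (⟨h1, ⟨v, hv, hvY⟩, w, hw, hwZ⟩ | ⟨h1 | h1, -⟩ | ⟨-, h1⟩)
    · rw [splitClause_union] at h1
      -- A model that meets the block lies inside it, so it cannot reach `w`.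
      exact (Finset.mem_sdiff.mp hwZ).2 (h.subset_block h1 (Finset.mem_inter.mp hvY).1 hv hw)
    · exact Finset.notMem_empty y (h1 ▸ Finset.mem_inter.mpr ⟨self_mem_block, hy⟩)
    · exact hG ((block_subset hy).antisymm (Finset.sdiff_eq_empty_iff_subset.mp h1))
    · simp_all
  · exact h.baseClauses c hc

theorem subset_block_of_sat_hypothesis {L : List (Record n)} (h : Sat (hypothesis T L) F)
    (hyF : y ∈ F) (hG : (y, G) ∈ L) (hF : F ⊆ G) : F ⊆ block T y G := by
  intro w hw
  by_contra hwB
  refine h _ (List.mem_append_left _ (List.mem_map_of_mem hG)) (violates_ofFalse_iff.mpr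
    (.inl ⟨?_, ⟨y, hyF, ?_⟩, w, hw, ?_⟩))
  · rwa [splitClause_union]
  · exact Finset.mem_inter.mpr ⟨self_mem_block, hF hyF⟩
  · exact Finset.mem_sdiff.mpr ⟨hF hw, hwB⟩

end Semantics

/-! ## The learning step -/

section Algorithm

variable {n : ℕ} {T : Mvdf n} {y : Fin n} {F G : Finset (Fin n)} {L : List (Record n)}

/-- Cut `F` down by the records for `y` in `L`. -/
noncomputable def refineStep (T : Mvdf n) (y : Fin n) (L : List (Record n)) (F : Finset (Fin n)) :
    Finset (Fin n) :=
  L.foldr (fun e F => if e.1 = y ∧ F ⊆ e.2 then F ∩ block T y e.2 else F) F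

/-- Cut `F` down until it satisfies the clauses of the records for `y` in `L`. -/
noncomputable def refine (T : Mvdf n) (y : Fin n) (L : List (Record n)) (F : Finset (Fin n)) :
    Finset (Fin n) :=
  (refineStep T y L)^[n] F

/-- The record `e` can be replaced by its union with `F`. -/
def Joins (T : Mvdf n) (y : Fin n) (F : Finset (Fin n)) (e : Record n) : Prop :=
  e.1 = y ∧ ¬ F ⊆ e.2 ∧ block T y (e.2 ∪ F) ≠ e.2 ∪ F

open Classical in
/-- Replace the last record that can be joined with `F`; the flag tells whether there was one. -/
noncomputable def joinLast (T : Mvdf n) (y : Fin n) (F : Finset (Fin n)) (L : List (Record n)) :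
    Bool × List (Record n) :=
  L.foldr (fun e p => if p.1 = false ∧ Joins T y F e then (true, (y, e.2 ∪ F) :: p.2)
    else (p.1, e :: p.2)) (false, [])

/-- Record that the block of `y` in `F` is not `F`. -/
noncomputable def addRecord (T : Mvdf n) (y : Fin n) (F : Finset (Fin n)) (L : List (Record n)) :
    List (Record n) :=
  if (joinLast T y F L).1 = true then (joinLast T y F L).2 else (y, F) :: L

/-- Learn about `y` from the fact that no model of the target has the set `G` of variables false. -/
noncomputable def update (T : Mvdf n) (G : Finset (Fin n)) (L : List (Record n)) (y : Fin n) :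
    List (Record n) :=
  if y ∈ G ∧ block T y (refine T y L G) ≠ refine T y L G then addRecord T y (refine T y L G) L
  else L

/-- Learn from the counterexample `e`. -/
noncomputable def learn (T : Mvdf n) (L : List (Record n)) (e : QuasiHornClause 2 n) :
    List (Record n) :=
  (List.finRange n).foldl (update T e.negᶜ) L

/-! ### Refining a set by the records -/

theorem refineStep_cons (e : Record n) : refineStep T y (e :: L) F =
    if e.1 = y ∧ refineStep T y L F ⊆ e.2 then refineStep T y L F ∩ block T y e.2
    else refineStep T y L F := rfl

theorem refineStep_subset : refineStep T y L F ⊆ F := by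
  induction L with
  | nil => exact subset_rfl
  | cons e L ih =>
    rw [refineStep_cons]
    split_ifs
    · exact Finset.inter_subset_left.trans ih
    · exact ih

theorem subset_block_of_refineStep_eq (h : refineStep T y L F = F) (hG : (y, G) ∈ L) (hF : F ⊆ G) :
    F ⊆ block T y G := by
  induction L with
  | nil => simp at hG
  | cons e L ih =>
    rw [refineStep_cons] at h
    have hL : refineStep T y L F = F := by
      refine refineStep_subset.antisymm ?_
      split_ifs at h
      · exact h.ge.trans Finset.inter_subset_left
      · exact h.ge
    rw [hL] at h
    rcases List.mem_cons.mp hG with rfl | hG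
    · rw [if_pos ⟨rfl, hF⟩] at h
      exact Finset.inter_eq_left.mp h
    · exact ih hL hG

theorem self_mem_refineStep (hy : y ∈ F) : y ∈ refineStep T y L F := by
  induction L with
  | nil => exact hy
  | cons e L ih =>
    rw [refineStep_cons]
    split_ifs
    · exact Finset.mem_inter.mpr ⟨ih, self_mem_block⟩
    · exact ih

theorem subset_refineStep {E : Finset (Fin n)} (hEF : E ⊆ F)
    (hE : ∀ G, (y, G) ∈ L → E ⊆ G → E ⊆ block T y G) : E ⊆ refineStep T y L F := by
  induction L with
  | nil => exact hEF
  | cons e L ih =>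
    have ih := ih fun G hG => hE G (List.mem_cons_of_mem _ hG)
    rw [refineStep_cons]
    split_ifs with h
    · obtain ⟨z, G⟩ := e
      obtain rfl : z = y := h.1
      exact Finset.subset_inter ih (hE G List.mem_cons_self (ih.trans h.2))
    · exact ih

theorem iterate_fixed_or_card_add_le {α : Type} (f : Finset α → Finset α) (hf : ∀ S, f S ⊆ S)
    (S : Finset α) (k : ℕ) : f (f^[k] S) = f^[k] S ∨ (f^[k] S).card + k ≤ S.card := by
  induction k with
  | zero => exact .inr le_rfl
  | succ k ih =>
    rw [Function.iterate_succ_apply']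
    rcases ih with h | h
    · exact .inl (by rw [h, h])
    · by_cases h1 : f (f^[k] S) = f^[k] S
      · exact .inl (by rw [h1, h1])
      · have := Finset.card_lt_card ((hf _).ssubset_of_ne h1)
        exact .inr (by omega)

/-- Each unstable round loses an element, so after `n` rounds the set is stable or empty, and the
empty set is stable too. -/
theorem refineStep_refine : refineStep T y L (refine T y L F) = refine T y L F := by
  rcases iterate_fixed_or_card_add_le (refineStep T y L) (fun _ => refineStep_subset) F n with h | h
  · exact h
  · have h1 : F.card ≤ n := by simpa using F.card_le_univ
    have h2 : refine T y L F = ∅ := Finset.card_eq_zero.mp (by rw [refine]; omega)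
    rw [h2]
    exact Finset.subset_empty.mp refineStep_subset

theorem refine_subset : refine T y L F ⊆ F :=
  Function.Iterate.rec (fun S => S ⊆ F) subset_rfl (fun _ h => refineStep_subset.trans h) n

theorem self_mem_refine (hy : y ∈ F) : y ∈ refine T y L F :=
  Function.Iterate.rec (fun S => y ∈ S) hy (fun _ h => self_mem_refineStep h) n

theorem subset_refine {E : Finset (Fin n)} (hEF : E ⊆ F)
    (hE : ∀ G, (y, G) ∈ L → E ⊆ G → E ⊆ block T y G) : E ⊆ refine T y L F :=
  Function.Iterate.rec (fun S => E ⊆ S) hEF (fun _ h => subset_refineStep h hE) n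

open Classical in
theorem joinLast_cons (e : Record n) : joinLast T y F (e :: L) =
    if (joinLast T y F L).1 = false ∧ Joins T y F e then
      (true, (y, e.2 ∪ F) :: (joinLast T y F L).2)
    else ((joinLast T y F L).1, e :: (joinLast T y F L).2) := rfl

/-- The fold from the right meets the oldest records first, so no record in the part `B` behind the
replaced one can be joined; the invariant depends on this. -/
theorem joinLast_spec (T : Mvdf n) (y : Fin n) (F : Finset (Fin n)) (L : List (Record n)) :
    (joinLast T y F L = (false, L) ∧ ∀ e ∈ L, ¬ Joins T y F e) ∨
      ∃ A G B, L = A ++ (y, G) :: B ∧ Joins T y F (y, G) ∧ (∀ e ∈ B, ¬ Joins T y F e) ∧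
        joinLast T y F L = (true, A ++ (y, G ∪ F) :: B) := by
  induction L with
  | nil => exact .inl ⟨rfl, by simp⟩
  | cons e L ih =>
    have hc := joinLast_cons (T := T) (y := y) (F := F) (L := L) e
    rcases ih with ⟨h1, h2⟩ | ⟨A, G, B, h1, h2, h3, h4⟩
    · by_cases he : Joins T y F e
      · obtain ⟨z, G⟩ := e
        obtain rfl : z = y := he.1
        exact .inr ⟨[], G, L, rfl, he, h2, by rw [hc, h1]; simp [he]⟩
      · exact .inl ⟨by rw [hc, h1]; simp [he], by simpa [he] using h2⟩
    · exact .inr ⟨e :: A, G, B, by rw [h1]; rfl, h2, h3, by rw [hc, h4]; simp⟩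

/-! ### Invariant and measure of progress -/

/-- The invariant of the learning algorithm. -/
structure Invariant (T : Mvdf n) (L : List (Record n)) : Prop where
  proper : Proper T L
  -- A clause crossed by the earlier entry cannot be crossed by the later one, since crossing
  -- includes containment in `c.Y ∪ c.Z`.
  pairwise : L.Pairwise fun new old => new.1 = old.1 →
    ∀ c ∈ T, Crosses c new.2 → ¬ old.2 ⊆ c.Y ∪ c.Z

/-- A measure of the progress made. -/
def weight (L : List (Record n)) : ℕ := (L.map fun e => e.2.card).sum

/-- Suppose `G ⊆ c.Y ∪ c.Z`. If `F ⊆ G`, then `F` lies in the block of `y` in `G`, which is on one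
side of `c`, although `F` crosses `c`. Otherwise `G ∪ F` crosses `c`, so its block is proper and the
join was possible. -/
theorem not_subset_of_not_joins (hyG : y ∈ G)
    (hst : F ⊆ G → F ⊆ block T y G) (hj : ¬ Joins T y F (y, G)) {c : MvdClause n} (hc : c ∈ T)
    (hF : Crosses c F) : ¬ G ⊆ c.Y ∪ c.Z := by
  intro hG
  obtain ⟨hFs, ⟨v, hv, hvY⟩, w, hw, hwZ⟩ := id hF
  have hcross : Crosses c (G ∪ F) := ⟨Finset.union_subset hG hFs,
    ⟨v, Finset.mem_union_right _ hv, hvY⟩, w, Finset.mem_union_right _ hw, hwZ⟩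
  by_cases h : F ⊆ G
  · exact hF.not_subset_block hc hyG hG (hst h)
  · exact hj ⟨rfl, h, hcross.block_ne hc (Finset.mem_union_left _ hyG)⟩

/-- Towards records behind it, a clause crossing `G ∪ F` crosses `G`, where the old invariant
applies, or `F`, where failure to join applies. Towards records in front, enlarging `G` only makes
containment in `c.Y ∪ c.Z` harder. -/
theorem invariant_addRecord (hL : Invariant T L) (hyF : y ∈ F) (hF : block T y F ≠ F)
    (hst : ∀ G, (y, G) ∈ L → F ⊆ G → F ⊆ block T y G) : Invariant T (addRecord T y F L) := by
  obtain ⟨hp, hw⟩ := hL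
  rcases joinLast_spec T y F L with ⟨h1, h2⟩ | ⟨A, G, B, rfl, h2, h3, h4⟩
  · rw [addRecord, h1, if_neg (by simp)]
    refine ⟨fun e he => ?_, List.pairwise_cons.mpr ⟨?_, hw⟩⟩
    · rcases List.mem_cons.mp he with rfl | he
      exacts [⟨hyF, hF⟩, hp e he]
    · rintro ⟨z, G⟩ he hz c hc hcF
      obtain rfl : y = z := hz
      exact not_subset_of_not_joins (hp _ he).1 (hst G he) (h2 _ he) hc hcF
  · rw [addRecord, h4, if_pos rfl]
    have hyG : y ∈ G := (hp (y, G) (by simp)).1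
    refine ⟨fun e he => ?_, ?_⟩
    · simp only [List.mem_append, List.mem_cons] at he
      rcases he with he | rfl | he
      · exact hp e (by simp [he])
      · exact ⟨Finset.mem_union_left _ hyG, h2.2.2⟩
      · exact hp e (by simp [he])
    · rw [List.pairwise_append, List.pairwise_cons] at hw ⊢
      obtain ⟨hA, ⟨hGB, hB⟩, hAB⟩ := hw
      refine ⟨hA, ⟨?_, hB⟩, ?_⟩
      · rintro ⟨z, E⟩ he hz c hc hcF
        obtain rfl : y = z := hz
        rcases crosses_or_crosses_of_union hyG hyF hcF with h | h
        · exact hGB _ he rfl c hc h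
        · exact not_subset_of_not_joins (hp (y, E) (by simp [he])).1
            (hst E (by simp [he])) (h3 _ he) hc h
      · intro a ha b hb
        rcases List.mem_cons.mp hb with rfl | hb
        · intro hay c hc hac hsub
          exact hAB a ha (y, G) List.mem_cons_self hay c hc hac
            (Finset.union_subset_left hsub)
        · exact hAB a ha b (List.mem_cons_of_mem _ hb)

theorem weight_lt_addRecord (hyF : y ∈ F) : weight L < weight (addRecord T y F L) := by
  rcases joinLast_spec T y F L with ⟨h1, -⟩ | ⟨A, G, B, rfl, h2, -, h4⟩
  · rw [addRecord, h1, if_neg (by simp)]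
    simpa [weight, Finset.card_pos] using ⟨y, hyF⟩
  · rw [addRecord, h4, if_pos rfl]
    have : G.card < (G ∪ F).card := Finset.card_lt_card
      -- The condition `¬ F ⊆ G` in `Joins` makes the union strictly larger.
      (Finset.subset_union_left.ssubset_of_ne fun h => h2.2.1 (Finset.union_eq_left.mp h.symm))
    simpa [weight] using this

theorem invariant_update (hL : Invariant T L) : Invariant T (update T G L y) := by
  rw [update]
  split_ifs with h
  · exact invariant_addRecord hL (self_mem_refine h.1) h.2
      fun E hE hF => subset_block_of_refineStep_eq refineStep_refine hE hF
  · exact hL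

theorem update_eq_or_weight_lt : update T G L y = L ∨ weight L < weight (update T G L y) := by
  rw [update]
  split_ifs with h
  · exact .inr (weight_lt_addRecord (self_mem_refine h.1))
  · exact .inl rfl

theorem invariant_learn (hL : Invariant T L) (e : QuasiHornClause 2 n) :
    Invariant T (learn T L e) := by
  rw [learn]
  generalize List.finRange n = l
  induction l generalizing L with
  | nil => exact hL
  | cons y l ih => exact ih (invariant_update hL)

/-- The list may already have changed before `y` is treated; but then the weight has grown, and
later updates never decrease it. -/
theorem weight_lt_learn {e : QuasiHornClause 2 n} (hy : update T e.negᶜ L y ≠ L) :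
    weight L < weight (learn T L e) := by
  have key : ∀ (l : List (Fin n)) (L : List (Record n)),
      (∀ z ∈ l, update T e.negᶜ L z = L) ∧ l.foldl (update T e.negᶜ) L = L ∨
        weight L < weight (l.foldl (update T e.negᶜ) L) := by
    intro l
    induction l with
    | nil => intro L; exact .inl ⟨by simp, rfl⟩
    | cons z l ih =>
      intro L
      rw [List.foldl_cons]
      rcases update_eq_or_weight_lt (T := T) (G := e.negᶜ) (L := L) (y := z) with h | h
      · rw [h]
        exact (ih L).imp_left fun ⟨h1, h2⟩ => ⟨by simpa [h] using h1, h2⟩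
      · rcases ih (update T e.negᶜ L z) with ⟨-, h2⟩ | h2
        · exact .inr (by rwa [h2])
        · exact .inr (h.trans h2)
  rcases key (List.finRange n) L with ⟨h, -⟩ | h
  · exact absurd (h y (List.mem_finRange y)) hy
  · exact h

/-- Every counterexample leads to progress. -/
theorem weight_lt_learn_of_counterexample {e : QuasiHornClause 2 n} (he : T.Entails e)
    (hn : ¬ (hypothesis T L).Entails e) : weight L < weight (learn T L e) := by
  rw [entails_iff] at he hn
  push Not at hn
  obtain ⟨E, hE, hd, hpos⟩ := hn
  have hT : ¬ Sat T E := fun h => he E h hd hpos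
  have hcard : 1 < E.card := by
    by_contra h
    exact hT ((sat_baseClauses_iff_of_card_le_one (not_lt.mp h)).mp
      (sat_mono (List.subset_append_right _ _) hE))
  obtain ⟨y, hy⟩ := Finset.card_pos.mp (zero_lt_one.trans hcard)
  have hEn : E ⊆ e.negᶜ := le_compl_iff_disjoint_left.mpr hd
  -- As a model of the hypothesis, `E` survives every cut.
  have hsub : E ⊆ refine T y L e.negᶜ :=
    subset_refine hEn fun G hG hEG => subset_block_of_sat_hypothesis hE hy hG hEG
  refine weight_lt_learn (y := y) fun h => ?_
  rw [update, if_pos] at h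
  · exact (weight_lt_addRecord (T := T) (L := L) (hsub hy)).ne' (congrArg weight h)
  · refine ⟨hEn hy, fun hb => ?_⟩
    -- Otherwise the refined set would be a model of `T` that falsifies `e`: it avoids `e.neg` and
    -- contains `E`, hence `e.pos`.
    refine he _ (sat_of_block_eq (hcard.trans_le (Finset.card_le_card hsub)) hb)
      (le_compl_iff_disjoint_left.mp refine_subset) (hpos.trans hsub)

/-- Choose for each record a clause of `T` that its set crosses; by the invariant, the pairs of
variable and clause are distinct. -/
theorem Invariant.length_le (hL : Invariant T L) : L.length ≤ n * T.length := by
  classical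
  have hex : ∀ e : Record n, ∃ c, e ∈ L → c ∈ T ∧ Crosses c e.2 := fun e => by
    by_cases he : e ∈ L
    · obtain ⟨c, hc⟩ := exists_crosses (hL.proper e he).1 (hL.proper e he).2
      exact ⟨c, fun _ => hc⟩
    · exact ⟨splitClause ∅ ∅, fun h => absurd h he⟩
  choose c hc using hex
  have hnd : (L.map fun e => (e.1, c e)).Nodup := by
    refine List.pairwise_map.mpr (hL.pairwise.imp_of_mem fun {a b} ha hb h heq => ?_)
    rw [Prod.mk.injEq] at heq
    exact h heq.1 (c a) (hc a ha).1 (hc a ha).2 (heq.2 ▸ (hc b hb).2.1)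
  calc L.length = (L.map fun e => (e.1, c e)).toFinset.card := by
        rw [List.toFinset_card_of_nodup hnd, List.length_map]
    _ ≤ (Finset.univ ×ˢ T.toFinset).card := Finset.card_le_card fun p hp => by
        obtain ⟨e, he, rfl⟩ := List.mem_map.mp (List.mem_toFinset.mp hp)
        simp [(hc e he).1]
    _ ≤ n * T.length := by
        rw [Finset.card_product, Finset.card_univ, Fintype.card_fin]
        exact Nat.mul_le_mul_left _ (List.toFinset_card_le T)

theorem Invariant.weight_le (hL : Invariant T L) : weight L ≤ n * T.length * n := by
  have h1 : weight L ≤ L.length * n := by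
    have := List.sum_le_card_nsmul (L.map fun e => e.2.card) n (by
      simp only [List.mem_map, forall_exists_index, and_imp]
      rintro _ e - rfl
      simpa using e.2.card_le_univ)
    simpa [weight] using this
  exact h1.trans (Nat.mul_le_mul_right _ hL.length_le)

theorem invariant_nil : Invariant T [] := ⟨by simp [Proper], List.Pairwise.nil⟩

end Algorithm

/-! ## The learning step takes polynomial time -/

namespace PolyTime

variable {α : ℕ → Type} [∀ n, Code (α n)] {A B : ∀ n, Mvdf n → α n → Finset (Fin n)}
  {y z : ∀ n, Mvdf n → α n → Fin n} {L : ∀ n, Mvdf n → α n → List (Record n)}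

theorem pairClause (hA : PolyTime A) (hy : PolyTime y) (hz : PolyTime z) :
    PolyTime (fun n T a => pairClause (A n T a) (y n T a) (z n T a)) :=
  (hA.compl.pair (hy.singleton.union hz.singleton)).congr fun n T a => by
    rw [← Finset.insert_eq]; rfl

theorem block (hy : PolyTime y) (hA : PolyTime A) :
    PolyTime (fun n T a => block T (y n T a) (A n T a)) := by
  classical
  refine (filter hA (q := fun n T (p : α n × Fin n) => p.2 = y n T p.1 ∨ p.2 ∈ A n T p.1 ∧
    ¬ T.Entails (ExactLearning.pairClause (A n T p.1) (y n T p.1) p.2)) ?_).of_eq fun n T a => ?_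
  · have h1 : PolyTime (fun n T (p : α n × Fin n) => p.2) := PolyTime.id.snd
    have h2 : PolyTime (fun n T (p : α n × Fin n) => y n T p.1) := hy.comp PolyTime.id.fst
    have h3 : PolyTime (fun n T (p : α n × Fin n) => A n T p.1) := hA.comp PolyTime.id.fst
    exact (PolyTimePred.eq h1 h2 fun n v w h => Finset.singleton_injective
      (codeSet_injective h)).or ((PolyTimePred.mem h1 h3).and (.not (.entails (h3.pairClause h2 h1))))
  · ext v; simp [ExactLearning.block]

theorem splitClause (hA : PolyTime A) (hB : PolyTime B) :
    PolyTime (fun n T a => splitClause (A n T a) (B n T a)) :=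
  (hB.compl.pair ((hA.inter hB).pair (hB.sdiff hA))).congr fun _ _ _ => rfl

theorem refineStep (hy : PolyTime y) (hL : PolyTime L) (hA : PolyTime A) :
    PolyTime (fun n T a => refineStep T (y n T a) (L n T a) (A n T a)) := by
  have h1 : PolyTime (fun n T (p : α n × (Record n × Finset (Fin n))) => y n T p.1) :=
    hy.comp PolyTime.id.fst
  have h2 : PolyTime (fun n T (p : α n × (Record n × Finset (Fin n))) => p.2.1.1) :=
    PolyTime.id.snd.fst.fst
  have h3 : PolyTime (fun n T (p : α n × (Record n × Finset (Fin n))) => p.2.1.2) :=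
    PolyTime.id.snd.fst.snd
  have h4 : PolyTime (fun n T (p : α n × (Record n × Finset (Fin n))) => p.2.2) :=
    PolyTime.id.snd.snd
  refine (foldr_of_growth (f := fun n T (p : α n × (Record n × Finset (Fin n))) =>
    if p.2.1.1 = y n T p.1 ∧ p.2.2 ⊆ p.2.1.2 then p.2.2 ∩ ExactLearning.block T (y n T p.1) p.2.1.2
      else p.2.2) (ite_prop ((PolyTimePred.eq h2 h1 fun n v w h => Finset.singleton_injective
      (codeSet_injective h)).and (.subset h4 h3)) (h4.inter (h1.block h3)) h4) hL hA (4 * X + 1)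
      fun n T a e F => ?_)
  refine (codeSize_set_le _).trans ?_
  have := le_codeSize_fin e.1
  have : codeSize e = codeSize e.1 + codeSize e.2 + 1 := rfl
  simp
  omega

theorem refine (hy : PolyTime y) (hL : PolyTime L) (hA : PolyTime A) :
    PolyTime (fun n T a => refine T (y n T a) (L n T a) (A n T a)) := by
  have h1 : PolyTime (fun n T (p : α n × (Fin n × Finset (Fin n))) => y n T p.1) :=
    hy.comp PolyTime.id.fst
  have h2 : PolyTime (fun n T (p : α n × (Fin n × Finset (Fin n))) => L n T p.1) :=
    hL.comp PolyTime.id.fst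
  refine (foldl_of_growth (h1.refineStep h2 PolyTime.id.snd.snd) hA.finRange hA (4 * X + 1)
    fun n T a v F => ?_).of_eq fun n T a => ?_
  · refine (codeSize_set_le _).trans ?_
    have := le_codeSize_fin v
    simp
    omega
  -- The variables folded over only count the `n` rounds.
  · rw [foldl_const (fun F => ExactLearning.refineStep T (y n T a) (L n T a) F),
      List.length_finRange]
    rfl

theorem joinLast (hy : PolyTime y) (hA : PolyTime A) (hL : PolyTime L) :
    PolyTime (fun n T a => joinLast T (y n T a) (A n T a) (L n T a)) := by
  classical
  have h1 : PolyTime (fun n T (p : α n × (Record n × (Bool × List (Record n)))) => y n T p.1) :=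
    hy.comp PolyTime.id.fst
  have h2 : PolyTime (fun n T (p : α n × (Record n × (Bool × List (Record n)))) => A n T p.1) :=
    hA.comp PolyTime.id.fst
  have h3 : PolyTime (fun n T (p : α n × (Record n × (Bool × List (Record n)))) => p.2.1) :=
    PolyTime.id.snd.fst
  have h4 : PolyTime (fun n T (p : α n × (Record n × (Bool × List (Record n)))) => p.2.2) :=
    PolyTime.id.snd.snd
  have hu := h3.snd.union h2
  have hj : PolyTimePred (fun n T (p : α n × (Record n × (Bool × List (Record n)))) =>
      Joins T (y n T p.1) (A n T p.1) p.2.1) :=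
    (PolyTimePred.eq h3.fst h1 fun n v w h => Finset.singleton_injective
      (codeSet_injective h)).and ((PolyTimePred.not (.subset h2 h3.snd)).and
        (.not (.eq (h1.block hu) hu fun _ => codeSet_injective)))
  have hc : PolyTimePred (fun n T (p : α n × (Record n × (Bool × List (Record n)))) =>
      p.2.2.1 = false) := (PolyTimePred.isTrue h4.fst).not.of_eq fun n T p => by simp
  refine foldr_of_growth (f := fun n T (p : α n × (Record n × (Bool × List (Record n)))) =>
    if p.2.2.1 = false ∧ Joins T (y n T p.1) (A n T p.1) p.2.1 then
      (true, (y n T p.1, p.2.1.2 ∪ A n T p.1) :: p.2.2.2) else (p.2.2.1, p.2.1 :: p.2.2.2))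
    (ite_prop (hc.and hj) ((const_bool true).pair ((h1.pair hu).cons h4.snd))
      (h4.fst.pair (h3.cons h4.snd))) hL
    ((const_bool false).pair (const_nil fun _ _ _ => rfl)) (10 * X + 10) fun n T a e p => ?_
  have k1 := codeSize_fin_le (y n T a)
  have k2 := codeSize_set_le (e.2 ∪ A n T a)
  have k3 := le_codeSize_fin e.1
  have k4 : codeSize e = codeSize e.1 + codeSize e.2 + 1 := rfl
  have k5 := codeSize_bool_le true
  have k6 := codeSize_pos p.1
  have k7 : codeSize p = codeSize p.1 + codeSize p.2 + 1 := rfl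
  dsimp only
  split_ifs <;> simp <;> omega

theorem addRecord (hy : PolyTime y) (hA : PolyTime A) (hL : PolyTime L) :
    PolyTime (fun n T a => addRecord T (y n T a) (A n T a) (L n T a)) :=
  (ite (joinLast hy hA hL).fst (joinLast hy hA hL).snd ((hy.pair hA).cons hL)).of_eq
    fun _ _ _ => rfl

theorem update (hA : PolyTime A) (hL : PolyTime L) (hy : PolyTime y) :
    PolyTime (fun n T a => update T (A n T a) (L n T a) (y n T a)) := by
  have hr := refine hy hL hA
  exact ite_prop ((PolyTimePred.mem hy hA).and (.not (.eq (hy.block hr) hr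
    fun _ => codeSet_injective))) (addRecord hy hr hL) hL

end PolyTime

/-- The additive growth that `foldl_of_growth` needs in `PolyTime.learn`: one record is prepended,
or one set is replaced. -/
theorem codeSize_addRecord_le {n : ℕ} (T : Mvdf n) (y : Fin n) (F : Finset (Fin n))
    (L : List (Record n)) : codeSize (addRecord T y F L) ≤ codeSize L + (8 * n + 10) := by
  have h1 := codeSize_fin_le y
  -- Concatenation drops the final `nil` of `A`, hence the `+ 1`.
  have happ : ∀ A B : List (Record n), codeSize (A ++ B) + 1 = codeSize A + codeSize B := by
    intro A B
    induction A with
    | nil => simp; omega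
    | cons e A ih => simp only [List.cons_append, codeSize_cons]; omega
  rcases joinLast_spec T y F L with ⟨h, -⟩ | ⟨A, G, B, rfl, -, -, h⟩
  · rw [addRecord, h, if_neg (by simp)]
    have := codeSize_set_le F
    simp
    omega
  · rw [addRecord, h, if_pos rfl]
    have := codeSize_set_le (G ∪ F)
    have := happ A ((y, G ∪ F) :: B)
    have := happ A ((y, G) :: B)
    simp only [codeSize_cons, codeSize_pair] at *
    omega

theorem codeSize_update_le {n : ℕ} (T : Mvdf n) (G : Finset (Fin n)) (L : List (Record n))
    (y : Fin n) : codeSize (update T G L y) ≤ codeSize L + (8 * n + 10) := by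
  rw [update]
  split_ifs
  · exact codeSize_addRecord_le ..
  · omega

theorem PolyTime.learn : PolyTime (fun n T (p : List (Record n) × QuasiHornClause 2 n) =>
    learn T p.1 p.2) := by
  have hneg : PolyTime (fun n T (e : QuasiHornClause 2 n) => e.neg) :=
    (PolyTime.fst (f := fun n _ (e : QuasiHornClause 2 n) => (e.neg, e.pos))
      (PolyTime.id.congr fun _ _ _ => rfl))
  have hA : PolyTime (fun n T (p : List (Record n) × QuasiHornClause 2 n) => p.2.negᶜ) :=
    (hneg.comp PolyTime.id.snd).compl
  refine foldl_of_growth (f := fun n T (p : (List (Record n) × QuasiHornClause 2 n) ×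
    (Fin n × List (Record n))) => ExactLearning.update T p.1.2.negᶜ p.2.2 p.2.1)
    (update (hA.comp PolyTime.id.fst) PolyTime.id.snd.snd PolyTime.id.snd.fst) hA.finRange
    PolyTime.id.fst (8 * X + 10) fun n T p y L => ?_
  refine (codeSize_update_le ..).trans ?_
  have := le_codeSize_fin y
  simp
  omega

theorem PolyTime.baseClauses : PolyTime (fun n T (_ : Finset (Fin n)) => baseClauses T) := by
  classical
  have hs : PolyTime (fun n T (p : Finset (Fin n) × (Fin n × Mvdf n)) => ({p.2.1} : Finset (Fin n))) :=
    PolyTime.id.snd.fst.singleton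
  have hv : PolyTime (fun n T (p : Finset (Fin n) × (Fin n × Mvdf n)) => p.2.1) :=
    PolyTime.id.snd.fst
  have hH : PolyTime (fun n T (p : Finset (Fin n) × (Fin n × Mvdf n)) => p.2.2) :=
    PolyTime.id.snd.snd
  have he : PolyTime (fun n T (_ : Finset (Fin n)) => (∅ : Finset (Fin n))) :=
    (PolyTime.id.sdiff PolyTime.id).of_eq fun n T a => by simp
  have hb : PolyTime (fun n T (_ : Finset (Fin n)) => bottomClause n) :=
    (he.compl.pair he).congr fun n T a => by simp only [Finset.compl_empty]; rfl
  refine (foldr_of_growth (f := fun n T (p : Finset (Fin n) × (Fin n × Mvdf n)) =>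
    if T.Entails (ExactLearning.pairClause {p.2.1} p.2.1 p.2.1) then
      ExactLearning.splitClause {p.2.1} {p.2.1} :: p.2.2 else p.2.2)
    (ite_prop (.entails (hs.pairClause hv hv)) ((hs.splitClause hs).cons hH) hH)
    (PolyTime.id (α := fun n => Finset (Fin n))).finRange
    (ite_prop (.entails hb) ((he.splitClause he).cons (const_nil fun _ _ _ => rfl))
      (const_nil (f := fun _ _ _ => []) fun _ _ _ => rfl)) (12 * X + 10)
      fun n T a v H => ?_).of_eq fun n T a => rfl
  have h1 := le_codeSize_fin v
  have h2 : codeSize (ExactLearning.splitClause {v} {v}) ≤ 12 * n + 5 := by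
    have e1 := codeSize_set_le (ExactLearning.splitClause {v} {v}).X
    have e2 := codeSize_set_le (ExactLearning.splitClause {v} {v}).Y
    have e3 := codeSize_set_le (ExactLearning.splitClause {v} {v}).Z
    have e4 : codeSize (ExactLearning.splitClause {v} {v}) =
      codeSize (ExactLearning.splitClause {v} {v}).X +
      (codeSize (ExactLearning.splitClause {v} {v}).Y +
      codeSize (ExactLearning.splitClause {v} {v}).Z + 1) + 1 := rfl
    omega
  dsimp only
  split_ifs
  · simp; omega
  · simp

theorem PolyTime.hypothesis : PolyTime (fun n T (p : Finset (Fin n) × List (Record n)) =>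
    hypothesis T p.2) := by
  have hG : PolyTime (fun n T (q : (Finset (Fin n) × List (Record n)) × Record n) => q.2.2) :=
    PolyTime.id.snd.snd
  have hy : PolyTime (fun n T (q : (Finset (Fin n) × List (Record n)) × Record n) => q.2.1) :=
    PolyTime.id.snd.fst
  exact (map ((hy.block hG).splitClause hG) PolyTime.id.snd).append
    (PolyTime.baseClauses.comp PolyTime.id.fst)

/-! ## The learning algorithm -/

section Program

/-- Ask the equivalence oracle about the current hypothesis, which is computed by `ch` from the
state in register `0`. -/
def askHypothesis (ch : Cmd) : Cmd :=
  .seq (.assign 1 (.reg 0)) (.seq ch (.equiv 1 (.reg 1)))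

/-- Treat the counterexample in register `1`. -/
def useCounterexample (cl : Cmd) : Cmd :=
  .seq (.assign 2 (.cons (.tail (.reg 0)) (.head (.reg 1))))
    (.seq cl (.assign 0 (.cons (.head (.reg 0)) (.reg 2))))

/-- The body of the learning algorithm. -/
def learnLoop (ch cl : Cmd) : Cmd :=
  .while (.reg 1) (.seq (useCounterexample cl) (askHypothesis ch))

/-- The learning algorithm. The empty formula is tested first, since the time allowed for it does
not depend on the number of variables. -/
def learner (ch co cl : Cmd) : Cmd :=
  .seq (.equiv 1 .nil) (.ite (.reg 1)
    (.seq (.assign 0 (.cons (.reg 0) .nil)) (.seq (.seq (askHypothesis ch) (learnLoop ch cl)) co))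
    (.assign 0 .nil))

variable {n : ℕ} {T : Mvdf n}

/-- The correctness of the output. -/
def IsOutput (T : Mvdf n) (s : Store) : Prop :=
  ∃ H : (mvdfFromQuasiHorn n).Rep, s 0 = (mvdfFromQuasiHorn n).codeRep H ∧
    (mvdfFromQuasiHorn n).μ H = (mvdfFromQuasiHorn n).μ T

/-- The state of the algorithm; the empty set tells the number of variables. -/
abbrev learnState (L : List (Record n)) : Finset (Fin n) × List (Record n) := (∅, L)

theorem codeSize_example_le (e : QuasiHornClause 2 n) : codeSize e ≤ 8 * n + 3 := by
  have h1 := codeSize_set_le e.neg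
  have h2 := codeSize_set_le e.pos
  have h3 : codeSize e = codeSize e.neg + codeSize e.pos + 1 := rfl
  omega

theorem le_codeSize_example (e : QuasiHornClause 2 n) : n ≤ codeSize e := by
  have h1 := le_codeSize_set e.neg
  have h3 : codeSize e = codeSize e.neg + codeSize e.pos + 1 := rfl
  omega

/-- The hypothesis follows from `T`, so counterexamples are of one kind only. -/
theorem not_entails_of_mem_symmDiff {L : List (Record n)} (hL : Proper T L)
    {e : QuasiHornClause 2 n}
    (he : e ∈ symmDiff ((mvdfFromQuasiHorn n).μ (hypothesis T L)) ((mvdfFromQuasiHorn n).μ T)) :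
    T.Entails e ∧ ¬ (hypothesis T L).Entails e := by
  rcases he with ⟨h1, h2⟩ | h
  · refine absurd ?_ h2
    change T.Entails e
    replace h1 : (hypothesis T L).Entails e := h1
    rw [entails_iff] at h1 ⊢
    exact fun F hF => h1 F (hF.hypothesis hL)
  · exact h

/-- `d` bounds how much the weight can still grow, hence the number of further counterexamples. A
round costs at most `B`, and one more `B` pays for the last query and the output. -/
theorem safe_learnLoop {ch co cl : Cmd} {bound : ℕ → ℕ} {S H l B : ℕ}
    (hch : ∀ (L : List (Record n)) (s : Store), s 1 = code (learnState L) → ∃ s' i,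
      BigStep (mvdfFromQuasiHorn n) T ch s s' i ∧ s' 1 = code (hypothesis T L) ∧ s' 0 = s 0 ∧
        (Invariant T L → i ≤ H))
    (hco : ∀ (L : List (Record n)) (s : Store), s 0 = code (learnState L) → ∃ s' i,
      BigStep (mvdfFromQuasiHorn n) T co s s' i ∧ s' 0 = code (hypothesis T L) ∧
        (Invariant T L → i ≤ H))
    (hcl : ∀ (L : List (Record n)) (e : QuasiHornClause 2 n) (s : Store), s 2 = code (L, e) →
      ∃ s' i, BigStep (mvdfFromQuasiHorn n) T cl s s' i ∧ s' 2 = code (learn T L e) ∧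
        s' 0 = s 0 ∧ (Invariant T L → i ≤ l))
    (hS : ∀ L, Invariant T L → codeSize (learnState L) ≤ S)
    (hH : ∀ L, Invariant T L → codeSize (hypothesis T L) ≤ H)
    (hB : B = 40 * (S + H + l + n) + 100) (b : ℕ) (hb : ∀ m, n ≤ m → b ≤ bound m) (d : ℕ)
    {L : List (Record n)} (hL : Invariant T L) (hd : n * T.length * n ≤ weight L + d) {s : Store}
    (hs : s 0 = code (learnState L)) {t m : ℕ} (ht : t + (d + 1) * B ≤ b) (hm : n ≤ m) :
    Safe (mvdfFromQuasiHorn n) T bound (IsOutput T)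
      ⟨[askHypothesis ch, learnLoop ch cl, co], s, t, m⟩ := by
  induction d using Nat.strong_induction_on generalizing L s t m with
  | _ d ih =>
    rw [Nat.succ_mul] at ht
    have kS := hS L hL
    have kH := hH L hL
    obtain ⟨s1, i1, hb1, hs1, hx1, hi1⟩ := hch L (Function.update s 1 (s 0)) (by simp [hs])
    replace hi1 := hi1 hL
    have h10 : s1 0 = code (learnState L) := by rw [hx1]; simp [hs]
    have e1 : Expr.cost s (.reg 0) ≤ S := by rw [Expr.cost, hs]; exact kS
    have e2 : Expr.cost s1 (.reg 1) ≤ H := by rw [Expr.cost, hs1]; exact kH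
    refine .seq (.assign (.seq (hb1.safe (.equiv (hypothesis T L) hs1 ?_ ?_ ?_))))
    · have := hb m hm
      omega
    · intro heq
      refine .whileFalse (by simp [Expr.eval]) ?_
      obtain ⟨s2, i2, hb2, hs2, hi2⟩ := hco L (Function.update s1 1 Data.nil) (by simp [h10])
      refine hb2.safe (.done ?_ ⟨_, hs2, heq⟩)
      have := hb m hm
      have := hi2 hL
      simp only [Expr.cost, Function.update_self, Data.size] at e1 e2 ⊢
      omega
    · intro (e : QuasiHornClause 2 n) he
      obtain ⟨hT, hn⟩ := not_entails_of_mem_symmDiff hL.proper he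
      have hw := weight_lt_learn_of_counterexample hT hn
      have hL' := invariant_learn hL e
      have hw' := hL'.weight_le
      -- The weight has just grown and is still at most `n * T.length * n`, so `d` was positive.
      obtain ⟨d, rfl⟩ : ∃ d', d = d' + 1 := ⟨d - 1, by omega⟩
      have kE := codeSize_example_le e
      have kS' := hS _ hL'
      set s2 := Function.update s1 1 (.cons ((mvdfFromQuasiHorn n).codeExample e) .nil) with hs2
      have h20 : s2 0 = code (learnState L) := by simp [hs2, h10]
      have h21 : s2 1 = .cons (code e) .nil := by simp [hs2]; rfl
      refine .whileTrue (by simp [Expr.eval, h21]) (.seq (.seq (.assign (.seq ?_))))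
      obtain ⟨s3, i3, hb3, hs3, hx3, hi3⟩ := hcl L e (Function.update s2 2
        (.cons (s2 0).tail (s2 1).head)) (by simp [h20, h21, Data.tail, Data.head])
      have h30 : s3 0 = code (learnState L) := by rw [hx3]; simp [h20]
      refine hb3.safe (.assign (ih d (by omega) hL' (by omega) ?_ ?_
        (hm.trans (le_max_left _ _))))
      · simp [Expr.eval, h30, hs3, Data.head]
      · have := hi3 hL
        simp only [codeSize] at kE kS kS'
        simp [Expr.cost, Expr.eval, h20, h21, h30, hs3, Data.head, Data.tail, Data.size]
          at e1 e2 kS kS' ⊢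
        omega

end Program

open MvPolynomial in
theorem polyTimeExactlyLearnable_mvdfFromQuasiHorn :
    PolyTimeExactlyLearnable mvdfFromQuasiHorn := by
  obtain ⟨p, hp, hcp⟩ := PolyTime.hypothesis
  obtain ⟨q, hq, hcq⟩ := PolyTime.learn
  obtain ⟨ch, hch⟩ := hcp 1
  obtain ⟨co, hco⟩ := hcp 0
  obtain ⟨cl, hcl⟩ := hcq 2
  -- At `K = |T| + n`, `S` bounds the state: the empty set, and at most `K * K` records of size at
  -- most `8 * K + 3`.
  set S : ℕ[X] := 4 * .X + 1 + (.X * .X * (8 * .X + 4) + 1) + 1 with hS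
  set B : ℕ[X] := 40 * (S + p.comp S + q.comp (S + 8 * .X + 5) + .X) + 100 with hB
  -- The weight is at most `K * K * K`, and `B` bounds a round; the remaining terms pay for the
  -- start.
  set P : ℕ[X] := (.X * .X * .X + 1) * B + 100 * .X + 100 with hP
  refine ⟨learner ch co cl, Polynomial.aeval (X 0 + X 1) P, fun n => ?_⟩
  have main : ∀ T : Mvdf n, Safe (mvdfFromQuasiHorn n) T
      (fun m => P.eval ((mvdfFromQuasiHorn n).sizeRep T + m)) (IsOutput T)
      (Config.init (learner ch co cl) n) := by
    intro T
    have hT : T.length ≤ codeSize T := length_le_codeSize T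
    have hT' : (mvdfFromQuasiHorn n).sizeRep T = codeSize T := rfl
    rw [hT']
    obtain ⟨K, hK⟩ : ∃ K, K = codeSize T + n := ⟨_, rfl⟩
    have hsize : ∀ L, Invariant T L → codeSize (learnState L) ≤ S.eval K := by
      intro L hL
      have h1 := codeSize_set_le (∅ : Finset (Fin n))
      have h2 := codeSize_list_le L (8 * n + 3) (fun e _ => by
        have h1 := codeSize_fin_le e.1
        have h2 := codeSize_set_le e.2
        have h3 : codeSize e = codeSize e.1 + codeSize e.2 + 1 := rfl
        omega)
      have h3 : L.length * (8 * n + 3 + 1) ≤ K * K * (8 * K + 4) := by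
        have : n ≤ K := by omega
        have : T.length ≤ K := by omega
        refine (Nat.mul_le_mul_right _ hL.length_le).trans ?_
        exact Nat.mul_le_mul (Nat.mul_le_mul ‹_› ‹_›) (by omega)
      simp only [hS, codeSize_pair, Polynomial.eval_add, Polynomial.eval_mul, Polynomial.eval_X,
        Polynomial.eval_ofNat, Polynomial.eval_one]
      omega
    -- A counterexample is at least `n` long, so after the first one the allowance covers `P` at
    -- `K`.
    have hbound : ∀ m, n ≤ m → P.eval K ≤ P.eval (codeSize T + m) := fun m hm =>
      eval_le_eval P (by omega)
    have hconst : ∀ m, 100 + 100 * m ≤ P.eval (codeSize T + m) := fun m => by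
      simp only [hP, Polynomial.eval_add, Polynomial.eval_mul, Polynomial.eval_X,
        Polynomial.eval_ofNat]
      omega
    have hPK : P.eval K = (K * K * K + 1) * B.eval K + 100 * K + 100 := by simp [hP]
    have hWK : (n * T.length * n + 1) * B.eval K ≤ (K * K * K + 1) * B.eval K := by
      have : n ≤ K := by omega
      have : T.length ≤ K := by omega
      gcongr
    refine .seq (.equiv ([] : Mvdf n) rfl (by have := hconst 0; omega) ?_ ?_)
    · intro heq
      refine .ite ?_
      rw [if_pos (by simp [Expr.eval])]
      refine .assign (.done ?_ ⟨([] : Mvdf n), by simp [Expr.eval]; rfl, heq⟩)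
      -- No counterexample has been seen here, so only a constant independent of `n` may be spent.
      have := hconst 0
      rw [add_zero] at this
      simp [Expr.cost, Data.size]
      omega
    · intro (e : QuasiHornClause 2 n) he
      refine .ite ?_
      rw [if_neg (by simp [Expr.eval])]
      have hsizeH : ∀ L, Invariant T L → codeSize (hypothesis T L) ≤ p.eval (S.eval K) :=
        fun L hL => (hp n T (learnState L)).trans (eval_le_eval p (hsize L hL))
      have hm : n ≤ max 0 ((mvdfFromQuasiHorn n).sizeExample e) :=
        (le_codeSize_example e).trans (le_max_right _ _)
      -- The unary `n` in register `0` is also the characteristic vector of the empty set, so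
      -- pairing it with `nil` gives the code of `learnState []`.
      have hinit : code (∅ : Finset (Fin n)) = Data.ofList (List.replicate n Data.nil) := by
        rw [← code_bits, bits_empty]
        simp [code, Data.ofBool]
      refine .seq (.assign (.seq (.seq ?_)))
      refine safe_learnLoop (S := S.eval K) (H := p.eval (S.eval K))
        (l := q.eval (S.eval K + 8 * K + 5)) (B := 40 * (S.eval K + p.eval (S.eval K) +
          q.eval (S.eval K + 8 * K + 5) + n) + 100) ?_ ?_ ?_ hsize hsizeH rfl (P.eval K) hbound
        (n * T.length * n) invariant_nil (by omega) ?_ ?_ hm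
      · intro L s hs
        obtain ⟨s', i, h1, h2, h3, h4⟩ := hch n T (learnState L) s hs
        exact ⟨s', i, h1, h2, h3 0 (by omega), fun hL =>
          h4.trans (eval_le_eval p (hsize L hL))⟩
      · intro L s hs
        obtain ⟨s', i, h1, h2, -, h4⟩ := hco n T (learnState L) s hs
        exact ⟨s', i, h1, h2, fun hL => h4.trans (eval_le_eval p (hsize L hL))⟩
      · intro L e s hs
        obtain ⟨s', i, h1, h2, h3, h4⟩ := hcl n T (L, e) s hs
        refine ⟨s', i, h1, h2, h3 0 (by omega), fun hL => h4.trans (eval_le_eval q ?_)⟩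
        have := hsize L hL
        have := codeSize_example_le e
        simp only [codeSize_pair] at *
        omega
      · simp [Expr.eval, hinit]
      · have := hPK
        have hBK : B.eval K = 40 * (S.eval K + p.eval (S.eval K) +
          q.eval (S.eval K + 8 * K + 5) + K) + 100 := by simp [hB]
        have hle : 40 * (S.eval K + p.eval (S.eval K) + q.eval (S.eval K + 8 * K + 5) + n) + 100 ≤
          B.eval K := by omega
        have := (Nat.mul_le_mul_left (n * T.length * n + 1) hle).trans hWK
        have hn1 := codeSize_set_le (∅ : Finset (Fin n))
        have hn2 := codeSize_example_le e
        have hn3 : ((mvdfFromQuasiHorn n).codeExample e).size = codeSize e := rfl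
        rw [codeSize, hinit] at hn1
        simp [Expr.cost, Expr.eval, Data.size, hn3]
        omega
  have heval : ∀ a b : ℕ, MvPolynomial.eval ![a, b] (Polynomial.aeval (X 0 + X 1) P) =
      P.eval (a + b) := fun a b => by
    rw [Polynomial.aeval_def, Polynomial.hom_eval₂]
    rw [Subsingleton.elim ((MvPolynomial.eval ![a, b]).comp (algebraMap ℕ _)) (RingHom.id ℕ),
      Polynomial.eval]
    simp
  refine ⟨fun T => ⟨(main T).no_infinite_run, fun cfg hr hs => ((main T).of_reachable hr).post hs⟩,
    fun T cfg hr => ?_⟩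
  rw [heval]
  exact ((main T).of_reachable hr).time_le

end ExactLearning


theorem mainTheorem5 :
    ExactLearning.PolyTimeExactlyLearnable ExactLearning.mvdfFromQuasiHorn :=
  ExactLearning.polyTimeExactlyLearnable_mvdfFromQuasiHorn
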